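/- Let $\epsilon>0$ and $0<b_-<b_+<\infty$, and let $b_\epsilon\in C^1(\mathbb{R})$ be real valued with $b_\epsilon(x)=b_-$ for $x<-\epsilon$, $b_\epsilon(x)=b_+$ for $x>\epsilon$, and $b_-\le b_\epsilon(x)\le b_+$ for $|x|\le\epsilon$. Put $\beta_\epsilon(x):=\int_0^x b_\epsilon(s)\,ds$ and, for $k\in\mathbb{R}$, let $h_\epsilon(k):=-\frac{d^2}{dx^2}+(k-\beta_\epsilon(x))^2$ be the self-adjoint Schrödinger operator in $L^2(\mathbb{R})$ on its maximal domain. Its spectrum consists of simple eigenvalues; let $\omega_{\epsilon,1}(k)<\omega_{\epsilon,2}(k)<\cdots$ denote these eigenvalues in increasing order. Then for every integer $j\ge 1$ and every $k\in\mathbb{R}$ with $|k|>b_+\epsilon$, the function $\omega_{\epsilon,j}$ is differentiable at $k$ and $$\omega_{\epsilon,j}'(k)>0.$$ -/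

import Mathlib

open MeasureTheory

noncomputable section

namespace Iwatsuka

/-- The Hilbert space `L²(ℝ)` of complex valued functions, with Lebesgue measure. -/
abbrev L2 : Type := Lp ℂ 2 (volume : Measure ℝ)

/-- `f` is continuously differentiable with derivative `f₁`, and `f₁` is locally absolutely
continuous with almost everywhere derivative `f₂` (i.e. `f₁` is a primitive of the locally
integrable function `f₂`). Equivalently `f ∈ W^{2,1}_loc(ℝ)`, with weak derivatives
`f₁` and `f₂`. -/
structure HasSecondDeriv (f f₁ f₂ : ℝ → ℂ) : Prop where
  hasDerivAt : ∀ x, HasDerivAt f (f₁ x) x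
  locallyIntegrable : LocallyIntegrable f₂ volume
  integral_eq : ∀ x y, ∫ t in x..y, f₂ t = f₁ y - f₁ x

theorem intervalIntegrable_of {f : ℝ → ℂ} (hf : LocallyIntegrable f volume) (x y : ℝ) :
    IntervalIntegrable f volume x y :=
  (hf.integrableOn_isCompact isCompact_uIcc).intervalIntegrable

/-- The graph of the maximal realization of `-d²/dx² + V` in `L²(ℝ)`: the pairs `(u, w)` of
elements of `L²(ℝ)` such that `u` has a representative `f` which is `C¹` with locally absolutely
continuous derivative, and `w = -f'' + V f` almost everywhere. -/
def schrodingerGraph (V : ℝ → ℝ) : Submodule ℂ (L2 × L2) where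
  carrier := {p | ∃ f f₁ f₂ : ℝ → ℂ, HasSecondDeriv f f₁ f₂ ∧
    (p.1 : ℝ → ℂ) =ᵐ[volume] f ∧
    (p.2 : ℝ → ℂ) =ᵐ[volume] fun x => -f₂ x + (V x : ℂ) * f x}
  add_mem' := by
    rintro ⟨u, w⟩ ⟨u', w'⟩ ⟨f, f₁, f₂, h, hu, hw⟩ ⟨g, g₁, g₂, h', hu', hw'⟩
    refine ⟨fun x => f x + g x, fun x => f₁ x + g₁ x, fun x => f₂ x + g₂ x,
      ⟨fun x => (h.hasDerivAt x).add (h'.hasDerivAt x),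
        h.locallyIntegrable.add h'.locallyIntegrable, fun x y => ?_⟩, ?_, ?_⟩
    · rw [intervalIntegral.integral_add (intervalIntegrable_of h.locallyIntegrable x y)
        (intervalIntegrable_of h'.locallyIntegrable x y), h.integral_eq, h'.integral_eq]
      ring
    · filter_upwards [Lp.coeFn_add u u', hu, hu'] with x h1 h2 h3
      simp only [Prod.fst_add, h1, Pi.add_apply]
      rw [h2, h3]
    · filter_upwards [Lp.coeFn_add w w', hw, hw'] with x h1 h2 h3
      simp only [Prod.snd_add, h1, Pi.add_apply]
      rw [h2, h3]
      ring
  zero_mem' := by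
    refine ⟨fun _ => 0, fun _ => 0, fun _ => 0,
      ⟨fun x => hasDerivAt_const x 0, locallyIntegrable_const 0, by simp⟩, ?_, ?_⟩
    · exact Lp.coeFn_zero ℂ 2 volume
    · filter_upwards [Lp.coeFn_zero ℂ 2 (volume : Measure ℝ)] with x hx
      simp
  smul_mem' := by
    rintro c ⟨u, w⟩ ⟨f, f₁, f₂, h, hu, hw⟩
    refine ⟨fun x => c * f x, fun x => c * f₁ x, fun x => c * f₂ x,
      ⟨fun x => (h.hasDerivAt x).const_mul c, h.locallyIntegrable.smul c, fun x y => ?_⟩, ?_, ?_⟩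
    · rw [intervalIntegral.integral_const_mul, h.integral_eq]
      ring
    · filter_upwards [Lp.coeFn_smul c u, hu] with x h1 h2
      simp only [Prod.smul_fst, h1, Pi.smul_apply, smul_eq_mul]
      rw [h2]
    · filter_upwards [Lp.coeFn_smul c w, hw] with x h1 h2
      simp only [Prod.smul_snd, h1, Pi.smul_apply, smul_eq_mul]
      rw [h2]
      ring

/-- The relation `schrodingerGraph V` is single valued. -/
theorem schrodingerGraph_single_valued (V : ℝ → ℝ) (p : L2 × L2)
    (hp : p ∈ schrodingerGraph V) (h0 : p.1 = 0) : p.2 = 0 := by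
  obtain ⟨f, f₁, f₂, h, hu, hw⟩ := hp
  have hf : f = 0 := by
    have hc : Continuous f :=
      continuous_iff_continuousAt.2 fun x => (h.hasDerivAt x).continuousAt
    refine (hc.ae_eq_iff_eq volume (continuous_const (y := (0 : ℂ)))).1 ?_
    rw [h0] at hu
    filter_upwards [hu, Lp.coeFn_zero ℂ 2 (volume : Measure ℝ)] with x h1 h2
    rw [← h1, h2]
    rfl
  subst hf
  have hf1 : ∀ x, f₁ x = 0 := fun x =>
    (h.hasDerivAt x).unique (hasDerivAt_const x (0 : ℂ))
  have hf2 : f₂ =ᵐ[volume] 0 := by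
    filter_upwards [LocallyIntegrable.ae_hasDerivAt_integral h.locallyIntegrable] with x hx
    have h1 := hx 0
    simp only [h.integral_eq, hf1, sub_zero] at h1
    exact h1.unique (hasDerivAt_const x (0 : ℂ))
  refine (Lp.eq_zero_iff_ae_eq_zero).2 ?_
  filter_upwards [hw, hf2] with x h1 h2
  simp [h1, h2]

/-- The Schrödinger operator `-d²/dx² + V` in `L²(ℝ)`, on its maximal domain. For a continuous
potential that is bounded below this is the unique self-adjoint realization. -/
def schrodinger (V : ℝ → ℝ) : L2 →ₗ.[ℂ] L2 :=
  (schrodingerGraph V).toLinearPMap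

theorem schrodinger_graph (V : ℝ → ℝ) : (schrodinger V).graph = schrodingerGraph V :=
  Submodule.toLinearPMap_graph_eq _ (schrodingerGraph_single_valued V)

/-- The point spectrum (real eigenvalues) of an unbounded operator in `L²(ℝ)`. -/
def eigenvalues (T : L2 →ₗ.[ℂ] L2) : Set ℝ :=
  {E | ∃ ψ : T.domain, (ψ : L2) ≠ 0 ∧ T ψ = (E : ℂ) • (ψ : L2)}

/-- The `j`-th element, `j = 1, 2, …`, of a set `S` of reals listed in increasing order: the
element of `S` that has exactly `j - 1` elements of `S` below it. There is at most one such
element; the value is `0` if there is none. -/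
def nthSmallest (S : Set ℝ) (j : ℕ) : ℝ :=
  sInf {x | x ∈ S ∧ {y | y ∈ S ∧ y < x}.encard + 1 = (j : ℕ∞)}

/-- The magnetic potential `β(x) = ∫₀ˣ b(s) ds`. -/
def beta (b : ℝ → ℝ) (x : ℝ) : ℝ := ∫ s in (0 : ℝ)..x, b s

/-- The fiber operator `h(k) = p_x² + (k - β(x))²` in `L²(ℝ)`. -/
def fiber (b : ℝ → ℝ) (k : ℝ) : L2 →ₗ.[ℂ] L2 :=
  schrodinger fun x => (k - beta b x) ^ 2

/-- The band function `ω_j`, `j = 1, 2, …`: `ω_j(k)` is the `j`-th eigenvalue of `h(k)` in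
increasing order (all eigenvalues of `h(k)` are simple). -/
def band (b : ℝ → ℝ) (j : ℕ) (k : ℝ) : ℝ := nthSmallest (eigenvalues (fiber b k)) j

/-- The magnetic fields of the smoothed model: `b_-` to the left of `-ε`, `b_+` to the right of
`ε`, and between `b_-` and `b_+` on `[-ε, ε]`. -/
structure IsSmoothedField (bm bp ε : ℝ) (b : ℝ → ℝ) : Prop where
  eq_right : ∀ x, ε < x → b x = bp
  eq_left : ∀ x, x < -ε → b x = bm
  mem_Icc : ∀ x, |x| ≤ ε → b x ∈ Set.Icc bm bp

end Iwatsuka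

end

open MeasureTheory

noncomputable section

namespace Iwatsuka

open Set Filter Topology

/-! Let `u` be a real eigenfunction for `ω_j(k)`, so `u'' = q u` with `q = (k - β)² - ω_j(k)`. The
proof rests on two identities. Feynman–Hellmann gives `ω_j'(k) ∫ u² = ∫ 2 (k - β) u²`. The virial
identity `∫ q' u² = 0`, obtained from `(q u² - u'²)' = q' u²`, reads `∫ 2 (k - β) b u² = 0`. Hence
for every constant `c`, `c ω_j'(k) ∫ u² = ∫ 2 (k - β)(c - b) u²`.

If `k > b_+ ε`, take `c = b_+`: for `x ≤ ε` one has `β(x) ≤ b_+ ε < k`, and for `x > ε` the factor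
`b_+ - b` vanishes. If `k < -b_+ ε`, take `c = b_-`, with the roles of the half-lines exchanged. In
both cases the integrand is nonnegative and not identically zero (`IsBoundedField.deriv_band_pos`).

The longer part is the differentiability of the band functions, done by Sturm theory. `mismatch`
measures at `R` the angle between the solutions decaying at `-∞` and at `+∞`. As a function of the
energy `E` it is continuous and strictly increasing, exceeds `-π`, is negative at `E = 0`, and lies
in `π ℤ` exactly at eigenvalues (`mem_eigenvalues_iff`). So the `j`-th eigenvalue is the root of
`mismatch = (j - 1) π`, which is continuous in `k` (`exists_band_root`). Integrating the derivative
of the Wronskian of the eigenfunctions at `k` and `k₀` gives an exact formula for the difference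
quotient of `ω_j`, and dominated convergence passes to the limit (`exists_hasDerivAt_band`). -/

/-! ### Prüfer angles: existence, comparison, continuous dependence. -/

/-- The vector field of the Prüfer equation for `u'' = q u`, where `u = r sin θ`,
`u' = r cos θ`. -/
def pruferField (q : ℝ → ℝ) (x θ : ℝ) : ℝ := Real.cos θ ^ 2 - q x * Real.sin θ ^ 2

/-- `θ` is a Prüfer angle for `u'' = q u`. -/
def IsPrufer (q θ : ℝ → ℝ) : Prop := ∀ x, HasDerivAt θ (pruferField q x (θ x)) x

/-- `u` solves `u'' = q u`, with `u' = v`. -/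
structure IsSol (q u v : ℝ → ℝ) : Prop where
  left : ∀ x, HasDerivAt u (v x) x
  right : ∀ x, HasDerivAt v (q x * u x) x

theorem sin_sq_sub_sin_sq (a b : ℝ) :
    Real.sin a ^ 2 - Real.sin b ^ 2 = Real.sin (a + b) * Real.sin (a - b) := by
  rw [Real.sin_add, Real.sin_sub]
  nlinarith [Real.sin_sq_add_cos_sq a, Real.sin_sq_add_cos_sq b]

theorem sin_eq_sinc_mul (x : ℝ) : Real.sin x = Real.sinc x * x := by
  rcases eq_or_ne x 0 with rfl | h
  · simp
  · rw [Real.sinc_of_ne_zero h]; field_simp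

/-- The factor in `pruferField q x a - pruferField q x b = pruferSlope q x a b * (a - b)`. -/
def pruferSlope (q : ℝ → ℝ) (x a b : ℝ) : ℝ :=
  -((1 + q x) * (Real.sin (a + b) * Real.sinc (a - b)))

/-- Writing the quotient with `sinc` keeps it continuous where the angles meet. The difference of
two Prüfer angles then solves a linear equation with continuous coefficient, which yields both the
Lipschitz bound and the comparison principles. -/
theorem pruferField_sub (q : ℝ → ℝ) (x a b : ℝ) :
    pruferField q x a - pruferField q x b = pruferSlope q x a b * (a - b) := by
  have h := sin_sq_sub_sin_sq a b
  rw [sin_eq_sinc_mul (a - b)] at h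
  rw [pruferField, pruferField, pruferSlope, Real.cos_sq', Real.cos_sq']
  linear_combination (-(1 + q x)) * h

theorem abs_pruferSlope_le (q : ℝ → ℝ) (x a b : ℝ) : |pruferSlope q x a b| ≤ 1 + |q x| := by
  rw [pruferSlope, abs_neg, abs_mul, abs_mul]
  have h1 : |Real.sin (a + b)| * |Real.sinc (a - b)| ≤ 1 :=
    mul_le_one₀ (Real.abs_sin_le_one _) (abs_nonneg _) (Real.abs_sinc_le_one _)
  have h2 : |1 + q x| ≤ 1 + |q x| := by
    simpa using abs_add_le 1 (q x)
  calc _ ≤ |1 + q x| * 1 := by gcongr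
    _ ≤ _ := by linarith

theorem abs_pruferField_le (q : ℝ → ℝ) (x a : ℝ) : |pruferField q x a| ≤ 1 + |q x| := by
  rw [pruferField]
  calc |Real.cos a ^ 2 - q x * Real.sin a ^ 2|
      ≤ |Real.cos a ^ 2| + |q x * Real.sin a ^ 2| := abs_sub _ _
    _ = Real.cos a ^ 2 + |q x| * Real.sin a ^ 2 := by
      rw [abs_mul, abs_of_nonneg (sq_nonneg (Real.cos a)), abs_of_nonneg (sq_nonneg (Real.sin a))]
    _ ≤ 1 + |q x| * 1 := by gcongr <;> [exact Real.cos_sq_le_one a; exact Real.sin_sq_le_one a]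
    _ = _ := by ring

theorem exists_abs_le {q : ℝ → ℝ} (hq : Continuous q) (a b : ℝ) :
    ∃ Q, 0 ≤ Q ∧ ∀ x ∈ Icc a b, |q x| ≤ Q := by
  obtain ⟨Q, hQ⟩ := isCompact_Icc.exists_bound_of_continuousOn (s := Icc a b) hq.continuousOn
  refine ⟨max Q 0, le_max_right _ _, fun x hx => (hQ x hx).trans (le_max_left _ _)⟩

theorem lipschitz_pruferField {q : ℝ → ℝ} {x : ℝ} {Q : ℝ} (hQ0 : 0 ≤ Q) (hQ : |q x| ≤ Q) :
    LipschitzWith (⟨1 + Q, by linarith⟩ : NNReal) (pruferField q x) := by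
  refine LipschitzWith.of_dist_le_mul fun a b => ?_
  rw [Real.dist_eq, Real.dist_eq, pruferField_sub, abs_mul]
  gcongr
  exact (abs_pruferSlope_le q x a b).trans (add_le_add_right hQ 1)

theorem exists_prufer_Icc {q : ℝ → ℝ} (hq : Continuous q) (x₀ θ₀ : ℝ) {n : ℝ} (hn : 0 ≤ n) :
    ∃ θ : ℝ → ℝ, θ x₀ = θ₀ ∧ ∀ x ∈ Icc (x₀ - n) (x₀ + n),
      HasDerivWithinAt θ (pruferField q x (θ x)) (Icc (x₀ - n) (x₀ + n)) x := by
  obtain ⟨Q, hQ0, hQ⟩ := exists_abs_le hq (x₀ - n) (x₀ + n)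
  have hmem : x₀ ∈ Icc (x₀ - n) (x₀ + n) := ⟨by linarith, by linarith⟩
  -- The field is bounded by `1 + Q`, so a ball of radius `(1 + Q) n` cannot be left within time
  -- `n`.
  have hP : IsPicardLindelof (pruferField q) (⟨x₀, hmem⟩ : Icc (x₀ - n) (x₀ + n)) θ₀
      (⟨(1 + Q) * n, by positivity⟩) 0 ⟨1 + Q, by linarith⟩ ⟨1 + Q, by linarith⟩ :=
    { lipschitzOnWith := fun t ht => (lipschitz_pruferField hQ0 (hQ t ht)).lipschitzOnWith
      continuousOn := fun x _ => by
        unfold pruferField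
        fun_prop
      norm_le := fun t ht x _ => (abs_pruferField_le q t x).trans (add_le_add_right (hQ t ht) 1)
      mul_max_le := by simp; exact le_rfl }
  exact hP.exists_eq_forall_mem_Icc_hasDerivWithinAt₀

/-- The field is globally Lipschitz in the angle, locally uniformly in `x`, so there is no blow-up;
the solutions on growing intervals agree by uniqueness and are glued. -/
theorem exists_prufer {q : ℝ → ℝ} (hq : Continuous q) (x₀ θ₀ : ℝ) :
    ∃ θ : ℝ → ℝ, θ x₀ = θ₀ ∧ IsPrufer q θ := by
  choose α hα0 hα using fun n : ℕ => exists_prufer_Icc hq x₀ θ₀ (n := n) (Nat.cast_nonneg n)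
  have hcont : ∀ n : ℕ, ContinuousOn (α n) (Icc (x₀ - n) (x₀ + n)) :=
    fun n x hx => (hα n x hx).continuousWithinAt
  have hder : ∀ (n : ℕ) (x : ℝ), x ∈ Ioo (x₀ - n) (x₀ + n) →
      HasDerivAt (α n) (pruferField q x (α n x)) x :=
    fun n x hx => (hα n x (Ioo_subset_Icc_self hx)).hasDerivAt (Icc_mem_nhds hx.1 hx.2)
  have hle : ∀ m n : ℕ, 0 < m → m ≤ n → EqOn (α m) (α n) (Icc (x₀ - m) (x₀ + m)) := by
    intro m n hm hmn
    have hm' : (0 : ℝ) < m := by exact_mod_cast hm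
    have hmn' : (m : ℝ) ≤ n := by exact_mod_cast hmn
    obtain ⟨Q, hQ0, hQ⟩ := exists_abs_le hq (x₀ - m) (x₀ + m)
    refine ODE_solution_unique_of_mem_Icc (v := pruferField q) (s := fun _ => univ)
      (K := ⟨1 + Q, by linarith⟩) (t₀ := x₀)
      (fun t ht => (lipschitz_pruferField hQ0 (hQ t (Ioo_subset_Icc_self ht))).lipschitzOnWith)
      ⟨by linarith, by linarith⟩ (hcont m) (hder m) (fun _ _ => mem_univ _)
      ((hcont n).mono (Icc_subset_Icc (by linarith) (by linarith)))
      (fun t ht => hder n t ⟨by linarith [ht.1], by linarith [ht.2]⟩) (fun _ _ => mem_univ _)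
      ((hα0 m).trans (hα0 n).symm)
  have heq : ∀ (m n : ℕ) (y : ℝ), |y - x₀| < m → |y - x₀| < n → α m y = α n y := by
    intro m n y hm hn
    have key : ∀ m n : ℕ, m ≤ n → |y - x₀| < m → α m y = α n y := by
      intro m n hmn hm
      have h1 := abs_lt.1 hm
      exact hle m n (by exact_mod_cast (abs_nonneg _).trans_lt hm) hmn
        ⟨by linarith [h1.1], by linarith [h1.2]⟩
    rcases le_total m n with h | h
    · exact key m n h hm
    · exact (key n m h hn).symm
  -- The index `⌊|x - x₀|⌋₊ + 1` exceeds `|x - x₀|` strictly, so `x` is interior to the interval of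
  -- the solution used there.
  refine ⟨fun x => α (⌊|x - x₀|⌋₊ + 1) x, hα0 _, fun x => ?_⟩
  set N := ⌊|x - x₀|⌋₊ + 1 with hN
  have hfl : ∀ y : ℝ, |y - x₀| < ((⌊|y - x₀|⌋₊ + 1 : ℕ) : ℝ) := fun y => by
    push_cast; exact Nat.lt_floor_add_one _
  have hx : |x - x₀| < N := hfl x
  have h1 := abs_lt.1 hx
  refine (hder N x ⟨by linarith [h1.1], by linarith [h1.2]⟩).congr_of_eventuallyEq ?_
  have : ∀ᶠ y in 𝓝 x, |y - x₀| < N :=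
    (continuous_abs.comp (continuous_id.sub continuous_const)).continuousAt.eventually_lt
      continuousAt_const hx
  filter_upwards [this] with y hy
  exact heq _ _ y (hfl y) hy

theorem IsPrufer.continuous {q θ : ℝ → ℝ} (h : IsPrufer q θ) : Continuous θ :=
  continuous_iff_continuousAt.2 fun x => (h x).continuousAt

/-- A linear differential inequality `d' ≥ c d` propagates `d ≥ 0` to the right. -/
theorem nonneg_of_deriv_ge {d d' c : ℝ → ℝ} (hc : Continuous c)
    (hd : ∀ x, HasDerivAt d (d' x) x) (h : ∀ x, c x * d x ≤ d' x) {a b : ℝ} (hab : a ≤ b)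
    (ha : 0 ≤ d a) : 0 ≤ d b := by
  set C : ℝ → ℝ := fun x => ∫ t in a..x, c t
  have hC : ∀ x, HasDerivAt C (c x) x := fun x => hc.integral_hasStrictDerivAt a x |>.hasDerivAt
  have hD : ∀ x, HasDerivAt (fun x => d x * Real.exp (-C x))
      (d' x * Real.exp (-C x) + d x * (Real.exp (-C x) * -c x)) x :=
    fun x => (hd x).mul (hC x).neg.exp
  have hmono : Monotone fun x => d x * Real.exp (-C x) := by
    refine monotone_of_deriv_nonneg (fun x => (hD x).differentiableAt) fun x => ?_
    rw [(hD x).deriv]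
    have := mul_nonneg (sub_nonneg.2 (h x)) (Real.exp_pos (-C x)).le
    linarith
  have h1 := hmono hab
  have h2 : 0 ≤ d b * Real.exp (-C b) :=
    (mul_nonneg ha (Real.exp_pos _).le).trans h1
  exact nonneg_of_mul_nonneg_left h2 (Real.exp_pos _)

theorem continuous_pruferSlope {q f g : ℝ → ℝ} (hq : Continuous q) (hf : Continuous f)
    (hg : Continuous g) : Continuous fun x => pruferSlope q x (f x) (g x) := by
  unfold pruferSlope
  have := Real.continuous_sinc
  fun_prop

theorem IsPrufer.ge_of_sub {q θ φ φ' : ℝ → ℝ} (hq : Continuous q) (hθ : IsPrufer q θ)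
    (hφ : ∀ x, HasDerivAt φ (φ' x) x) (h : ∀ x, φ' x ≤ pruferField q x (φ x)) {a b : ℝ}
    (hab : a ≤ b) (ha : φ a ≤ θ a) : φ b ≤ θ b := by
  have hφc : Continuous φ := continuous_iff_continuousAt.2 fun x => (hφ x).continuousAt
  have := nonneg_of_deriv_ge (continuous_pruferSlope hq hθ.continuous hφc)
    (fun x => (hθ x).sub (hφ x)) (fun x => ?_) hab (sub_nonneg.2 ha)
  · exact sub_nonneg.1 this
  · have := pruferField_sub q x (θ x) (φ x)
    have := h x
    simp only [Pi.sub_apply]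
    linarith

theorem IsPrufer.le_of_super {q θ φ φ' : ℝ → ℝ} (hq : Continuous q) (hθ : IsPrufer q θ)
    (hφ : ∀ x, HasDerivAt φ (φ' x) x) (h : ∀ x, pruferField q x (φ x) ≤ φ' x) {a b : ℝ}
    (hab : a ≤ b) (ha : θ a ≤ φ a) : θ b ≤ φ b := by
  have hφc : Continuous φ := continuous_iff_continuousAt.2 fun x => (hφ x).continuousAt
  have := nonneg_of_deriv_ge (continuous_pruferSlope hq hφc hθ.continuous)
    (fun x => (hφ x).sub (hθ x)) (fun x => ?_) hab (sub_nonneg.2 ha)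
  · exact sub_nonneg.1 this
  · have := pruferField_sub q x (φ x) (θ x)
    have := h x
    simp only [Pi.sub_apply]
    linarith

/-- Multiples of `π` are only crossed upwards. -/
theorem IsPrufer.int_mul_pi_le {q θ : ℝ → ℝ} (hq : Continuous q) (hθ : IsPrufer q θ) (n : ℤ)
    {a b : ℝ} (hab : a ≤ b) (ha : n * Real.pi ≤ θ a) : n * Real.pi ≤ θ b :=
  hθ.ge_of_sub hq (fun x => hasDerivAt_const x ((n : ℝ) * Real.pi))
    (fun x => by simp [pruferField, sq_nonneg]) hab ha

/-- Prüfer angles are increasing in `-q`. -/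
theorem IsPrufer.mono {q₁ q₂ θ₁ θ₂ : ℝ → ℝ} (hq : Continuous q₂) (h₁ : IsPrufer q₁ θ₁)
    (h₂ : IsPrufer q₂ θ₂) (h : ∀ x, q₂ x ≤ q₁ x) {a b : ℝ} (hab : a ≤ b) (ha : θ₁ a ≤ θ₂ a) :
    θ₁ b ≤ θ₂ b :=
  h₂.ge_of_sub hq h₁ (fun x => by
    have := mul_le_mul_of_nonneg_right (h x) (sq_nonneg (Real.sin (θ₁ x)))
    simp only [pruferField]; linarith) hab ha

/-- Prüfer angles depend Lipschitz continuously on the data. -/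
theorem IsPrufer.abs_sub_le {q₁ q₂ θ₁ θ₂ : ℝ → ℝ} (h₁ : IsPrufer q₁ θ₁)
    (h₂ : IsPrufer q₂ θ₂) {a b Q G δ : ℝ} (hab : a ≤ b)
    (hQ : ∀ x ∈ Icc a b, |q₁ x| ≤ Q) (hG : ∀ x ∈ Icc a b, |q₁ x - q₂ x| ≤ G)
    (ha : |θ₁ a - θ₂ a| ≤ δ) : |θ₁ b - θ₂ b| ≤ gronwallBound δ (1 + Q) G (b - a) := by
  refine norm_le_gronwallBound_of_norm_deriv_right_le (f := fun x => θ₁ x - θ₂ x)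
    (f' := fun x => pruferField q₁ x (θ₁ x) - pruferField q₂ x (θ₂ x))
    (h₁.continuous.sub h₂.continuous).continuousOn
    (fun x _ => ((h₁ x).sub (h₂ x)).hasDerivWithinAt) ha (fun x hx => ?_) b ⟨hab, le_rfl⟩
  have hx' := Ico_subset_Icc_self hx
  have e : pruferField q₁ x (θ₁ x) - pruferField q₂ x (θ₂ x) =
      pruferSlope q₁ x (θ₁ x) (θ₂ x) * (θ₁ x - θ₂ x)
        - (q₁ x - q₂ x) * Real.sin (θ₂ x) ^ 2 := by
    rw [← pruferField_sub]; simp only [pruferField]; ring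
  rw [Real.norm_eq_abs, Real.norm_eq_abs, e]
  refine (abs_sub _ _).trans ?_
  rw [abs_mul, abs_mul, abs_of_nonneg (sq_nonneg (Real.sin (θ₂ x)))]
  have h3 := (abs_pruferSlope_le q₁ x (θ₁ x) (θ₂ x)).trans (add_le_add_right (hQ x hx') 1)
  have h4 := hG x hx'
  have : |q₁ x - q₂ x| * Real.sin (θ₂ x) ^ 2 ≤ G * 1 :=
    mul_le_mul h4 (Real.sin_sq_le_one _) (sq_nonneg _) ((abs_nonneg _).trans h4)
  have := mul_le_mul_of_nonneg_right h3 (abs_nonneg (θ₁ x - θ₂ x))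
  linarith

/-! ### Solutions of `u'' = q u`: existence, uniqueness, Wronskians. -/

/-- In polar coordinates the radius obeys `r' = (1 + q) sin θ cos θ · r`, so it is an explicit
exponential and never vanishes. -/
theorem IsPrufer.exists_isSol {q θ : ℝ → ℝ} (hq : Continuous q) (hθ : IsPrufer q θ) (x₀ : ℝ) :
    ∃ r : ℝ → ℝ, (∀ x, 0 < r x) ∧ r x₀ = 1 ∧
      IsSol q (fun x => r x * Real.sin (θ x)) (fun x => r x * Real.cos (θ x)) := by
  set g : ℝ → ℝ := fun x => (1 + q x) * (Real.sin (θ x) * Real.cos (θ x))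
  have hg : Continuous g := by
    have := hθ.continuous
    fun_prop
  have hr : ∀ x, HasDerivAt (fun x => Real.exp (∫ t in x₀..x, g t))
      (Real.exp (∫ t in x₀..x, g t) * g x) x :=
    fun x => (hg.integral_hasStrictDerivAt x₀ x).hasDerivAt.exp
  refine ⟨fun x => Real.exp (∫ t in x₀..x, g t), fun x => Real.exp_pos _, by simp, ?_, ?_⟩
  · intro x
    refine ((hr x).mul (hθ x).sin).congr_deriv ?_
    simp only [g, pruferField]
    linear_combination Real.exp (∫ t in x₀..x, g t) * Real.cos (θ x) *
      Real.sin_sq_add_cos_sq (θ x)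
  · intro x
    refine ((hr x).mul (hθ x).cos).congr_deriv ?_
    simp only [g, pruferField]
    linear_combination Real.exp (∫ t in x₀..x, g t) * q x * Real.sin (θ x) *
      Real.sin_sq_add_cos_sq (θ x)

theorem IsSol.const_mul {q u v : ℝ → ℝ} (h : IsSol q u v) (c : ℝ) :
    IsSol q (fun x => c * u x) (fun x => c * v x) :=
  ⟨fun x => (h.left x).const_mul c, fun x => ((h.right x).const_mul c).congr_deriv (by ring)⟩

theorem IsSol.sub {q u v u' v' : ℝ → ℝ} (h : IsSol q u v) (h' : IsSol q u' v') :
    IsSol q (fun x => u x - u' x) (fun x => v x - v' x) :=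
  ⟨fun x => (h.left x).sub (h'.left x),
    fun x => ((h.right x).sub (h'.right x)).congr_deriv (by ring)⟩

theorem IsSol.reflect {q u v : ℝ → ℝ} (h : IsSol q u v) :
    IsSol (fun x => q (-x)) (fun x => u (-x)) (fun x => -v (-x)) :=
  ⟨fun x => ((h.left (-x)).scomp x (hasDerivAt_neg x)).congr_deriv (by simp),
    fun x => ((h.right (-x)).scomp x (hasDerivAt_neg x)).neg.congr_deriv (by simp)⟩

theorem IsSol.continuous_left {q u v : ℝ → ℝ} (h : IsSol q u v) : Continuous u :=
  continuous_iff_continuousAt.2 fun x => (h.left x).continuousAt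

theorem IsSol.continuous_right {q u v : ℝ → ℝ} (h : IsSol q u v) : Continuous v :=
  continuous_iff_continuousAt.2 fun x => (h.right x).continuousAt

theorem exists_isSol {q : ℝ → ℝ} (hq : Continuous q) (x₀ a b : ℝ) :
    ∃ u v, IsSol q u v ∧ u x₀ = a ∧ v x₀ = b := by
  -- Since `u = r sin θ` and `v = r cos θ`, the initial angle is the argument of `v + i u`, that is
  -- of `b + i a`.
  obtain ⟨θ, hθ0, hθ⟩ := exists_prufer hq x₀ (Complex.arg ⟨b, a⟩)
  obtain ⟨r, -, hr, h⟩ := hθ.exists_isSol hq x₀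
  refine ⟨_, _, h.const_mul ‖(⟨b, a⟩ : ℂ)‖, ?_, ?_⟩
  · simp [hr, hθ0, Complex.norm_mul_sin_arg]
  · simp [hr, hθ0, Complex.norm_mul_cos_arg]

/-- Gronwall estimate for `d'' = q d + g`. -/
theorem abs_le_gronwallBound {d e q g : ℝ → ℝ} (hd : ∀ x, HasDerivAt d (e x) x)
    (he : ∀ x, HasDerivAt e (q x * d x + g x) x) {a b Q G δ : ℝ} (hQ0 : 0 ≤ Q)
    (hQ : ∀ x ∈ Icc a b, |q x| ≤ Q) (hG : ∀ x ∈ Icc a b, |g x| ≤ G)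
    (hda : |d a| ≤ δ) (hea : |e a| ≤ δ) {x : ℝ} (hx : x ∈ Icc a b) :
    |d x| ≤ gronwallBound δ (1 + Q) G (x - a) ∧ |e x| ≤ gronwallBound δ (1 + Q) G (x - a) := by
  have hdc : Continuous d := continuous_iff_continuousAt.2 fun x => (hd x).continuousAt
  have hec : Continuous e := continuous_iff_continuousAt.2 fun x => (he x).continuousAt
  have := norm_le_gronwallBound_of_norm_deriv_right_le (f := fun x => (d x, e x))
    (f' := fun x => (e x, q x * d x + g x)) (δ := δ) (K := 1 + Q) (ε := G) (a := a) (b := b)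
    (hdc.prodMk hec).continuousOn
    (fun x _ => ((hd x).prodMk (he x)).hasDerivWithinAt) (by simp [Prod.norm_def, hda, hea])
    (fun y hy => ?_) x hx
  · simpa [Prod.norm_def] using this
  · have hy' := Ico_subset_Icc_self hy
    have hG0 := (abs_nonneg _).trans (hG y hy')
    simp only [Prod.norm_def, Real.norm_eq_abs]
    have h1 := le_max_left |d y| |e y|
    have h2 := le_max_right |d y| |e y|
    have h0 : 0 ≤ max |d y| |e y| := (abs_nonneg _).trans h1
    refine max_le (by nlinarith) ?_
    refine (abs_add_le _ _).trans ?_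
    rw [abs_mul]
    have := mul_le_mul (hQ y hy') h1 (abs_nonneg _) hQ0
    linarith [hG y hy']

theorem IsSol.abs_le {q u v : ℝ → ℝ} (h : IsSol q u v) {a b Q δ : ℝ} (hQ0 : 0 ≤ Q)
    (hQ : ∀ x ∈ Icc a b, |q x| ≤ Q) (hu : |u a| ≤ δ) (hv : |v a| ≤ δ) {x : ℝ}
    (hx : x ∈ Icc a b) :
    |u x| ≤ δ * Real.exp ((1 + Q) * (x - a)) ∧ |v x| ≤ δ * Real.exp ((1 + Q) * (x - a)) := by
  have := abs_le_gronwallBound (g := fun _ => 0) h.left (fun x => by simpa using h.right x) hQ0 hQ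
    (G := 0) (by simp) hu hv hx
  rwa [gronwallBound_ε0] at this

theorem IsSol.eq_zero {q u v : ℝ → ℝ} (hq : Continuous q) (h : IsSol q u v) {x₀ : ℝ}
    (hu : u x₀ = 0) (hv : v x₀ = 0) (x : ℝ) : u x = 0 ∧ v x = 0 := by
  have key : ∀ {q u v : ℝ → ℝ} (_ : Continuous q) (_ : IsSol q u v) {x₀ : ℝ}
      (_ : u x₀ = 0) (_ : v x₀ = 0) (x : ℝ) (_ : x₀ ≤ x), u x = 0 ∧ v x = 0 := by
    intro q u v hq h x₀ hu hv x hx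
    obtain ⟨Q, hQ0, hQ⟩ := exists_abs_le hq x₀ x
    simpa using h.abs_le hQ0 hQ (δ := 0) (by simp [hu]) (by simp [hv]) ⟨hx, le_rfl⟩
  rcases le_total x₀ x with hx | hx
  · exact key hq h hu hv x hx
  · have := key (hq.comp continuous_neg) h.reflect (x₀ := -x₀) (by simpa using hu)
      (by simpa using hv) (-x) (by linarith)
    simpa using this

theorem IsSol.unique {q u v u' v' : ℝ → ℝ} (hq : Continuous q) (h : IsSol q u v)
    (h' : IsSol q u' v') {x₀ : ℝ} (hu : u x₀ = u' x₀) (hv : v x₀ = v' x₀) : u = u' ∧ v = v' := by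
  have := (h.sub h').eq_zero hq (x₀ := x₀) (by simp [hu]) (by simp [hv])
  exact ⟨funext fun x => sub_eq_zero.1 (this x).1, funext fun x => sub_eq_zero.1 (this x).2⟩

theorem IsSol.hasDerivAt_wronskian {q₁ q₂ u₁ v₁ u₂ v₂ : ℝ → ℝ} (h₁ : IsSol q₁ u₁ v₁)
    (h₂ : IsSol q₂ u₂ v₂) (x : ℝ) :
    HasDerivAt (fun x => v₁ x * u₂ x - u₁ x * v₂ x) ((q₁ x - q₂ x) * (u₁ x * u₂ x)) x :=
  (((h₁.right x).mul (h₂.left x)).sub ((h₁.left x).mul (h₂.right x))).congr_deriv (by ring)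

theorem IsSol.wronskian_eq {q u₁ v₁ u₂ v₂ : ℝ → ℝ} (h₁ : IsSol q u₁ v₁)
    (h₂ : IsSol q u₂ v₂) (x y : ℝ) :
    v₁ x * u₂ x - u₁ x * v₂ x = v₁ y * u₂ y - u₁ y * v₂ y :=
  is_const_of_deriv_eq_zero (fun x => (h₁.hasDerivAt_wronskian h₂ x).differentiableAt)
    (fun x => by rw [(h₁.hasDerivAt_wronskian h₂ x).deriv]; ring) x y

theorem le_of_deriv_nonneg {f f' : ℝ → ℝ} (hf : ∀ x, HasDerivAt f (f' x) x) {a b : ℝ}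
    (h : ∀ x ∈ Icc a b, 0 ≤ f' x) (hab : a ≤ b) : f a ≤ f b := by
  refine monotoneOn_of_deriv_nonneg (convex_Icc a b)
    (fun x _ => (hf x).continuousAt.continuousWithinAt)
    (fun x _ => (hf x).differentiableAt.differentiableWithinAt)
    (fun x hx => ?_) ⟨le_rfl, hab⟩ ⟨hab, le_rfl⟩ hab
  rw [(hf x).deriv]
  exact h x (interior_subset hx)

theorem le_of_deriv_nonpos {f f' : ℝ → ℝ} (hf : ∀ x, HasDerivAt f (f' x) x) {a b : ℝ}
    (h : ∀ x ∈ Icc a b, f' x ≤ 0) (hab : a ≤ b) : f b ≤ f a :=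
  neg_le_neg_iff.1 (le_of_deriv_nonneg (fun x => (hf x).neg)
    (fun x hx => neg_nonneg.2 (h x hx)) hab)

theorem pos_of_ne_zero {f : ℝ → ℝ} (hf : Continuous f) {a : ℝ} (ha : 0 < f a)
    (h : ∀ x, a ≤ x → f x ≠ 0) {x : ℝ} (hx : a ≤ x) : 0 < f x := by
  by_contra hneg
  obtain ⟨y, hy, hy0⟩ := intermediate_value_Icc' hx hf.continuousOn
    (show (0 : ℝ) ∈ Icc (f x) (f a) from ⟨not_lt.1 hneg, ha.le⟩)
  exact h y hy.1 hy0

theorem IsSol.hasDerivAt_mul {q u v : ℝ → ℝ} (h : IsSol q u v) (x : ℝ) :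
    HasDerivAt (fun x => u x * v x) (v x ^ 2 + q x * u x ^ 2) x :=
  ((h.left x).mul (h.right x)).congr_deriv (by ring)

theorem IsSol.hasDerivAt_sq_left {q u v : ℝ → ℝ} (h : IsSol q u v) (x : ℝ) :
    HasDerivAt (fun x => u x ^ 2) (2 * (u x * v x)) x :=
  ((h.left x).pow 2).congr_deriv (by norm_num; ring)

theorem IsSol.hasDerivAt_sq_right {q u v : ℝ → ℝ} (h : IsSol q u v) (x : ℝ) :
    HasDerivAt (fun x => v x ^ 2) (2 * q x * (u x * v x)) x :=
  ((h.right x).pow 2).congr_deriv (by norm_num; ring)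

/-- Solutions entering the first quadrant stay there as long as `q ≥ 0`. -/
theorem IsSol.nonneg {q u v : ℝ → ℝ} (h : IsSol q u v) {a : ℝ} (hq : ∀ x, a ≤ x → 0 ≤ q x)
    (hu : 0 ≤ u a) (hv : 0 ≤ v a) (huv : 0 < u a ∨ 0 < v a) {x : ℝ} (hx : a ≤ x) :
    u a ≤ u x ∧ v a ≤ v x := by
  have h1 : ∀ x, a ≤ x → 0 ≤ u x * v x := fun x hx =>
    (mul_nonneg hu hv).trans (le_of_deriv_nonneg h.hasDerivAt_mul (fun y hy => by
      have := hq y hy.1; positivity) hx)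
  have h2 : ∀ x, a ≤ x → u a ^ 2 ≤ u x ^ 2 := fun x hx =>
    le_of_deriv_nonneg h.hasDerivAt_sq_left (fun y hy => by have := h1 y hy.1; positivity) hx
  have h3 : ∀ x, a ≤ x → v a ^ 2 ≤ v x ^ 2 := fun x hx =>
    le_of_deriv_nonneg h.hasDerivAt_sq_right (fun y hy => by
      have := h1 y hy.1; have := hq y hy.1; positivity) hx
  have h4 : ∀ x, a ≤ x → 0 ≤ u x ∧ 0 ≤ v x := by
    intro x hx
    rcases huv with h0 | h0
    · have hpos := pos_of_ne_zero h.continuous_left h0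
        (fun y hy h' => by have := h2 y hy; rw [h'] at this; nlinarith) hx
      exact ⟨hpos.le, nonneg_of_mul_nonneg_right (h1 x hx) hpos⟩
    · have hpos := pos_of_ne_zero h.continuous_right h0
        (fun y hy h' => by have := h3 y hy; rw [h'] at this; nlinarith) hx
      exact ⟨nonneg_of_mul_nonneg_left (h1 x hx) hpos, hpos.le⟩
  exact ⟨le_of_deriv_nonneg h.left (fun y hy => (h4 y hy.1).2) hx,
    le_of_deriv_nonneg h.right (fun y hy => mul_nonneg (hq y hy.1) (h4 y hy.1).1) hx⟩

/-! ### The decaying solution on a half-line. -/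

/-- The solution of `u'' = q u` decaying at `+∞`, normalized at `R`. -/
structure IsWeyl (q : ℝ → ℝ) (R : ℝ) (u v : ℝ → ℝ) : Prop where
  isSol : IsSol q u v
  normalized : u R = 1
  pos : ∀ x, R ≤ x → 0 < u x
  nonpos : ∀ x, R ≤ x → v x ≤ 0

/-- With `c`, `s` the fundamental solutions at `R`, a solution `c - t s` is nonnegative and
nonincreasing as soon as `c'/s' ≤ t ≤ c/s` throughout. Such a `t` exists because `c'/s'` is
nondecreasing, `c/s` is nonincreasing, and the Wronskian keeps the first below the second. -/
theorem exists_isWeyl {q : ℝ → ℝ} (hq : Continuous q) {R : ℝ} (h1 : ∀ x, R ≤ x → 1 ≤ q x) :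
    ∃ u v, IsWeyl q R u v := by
  have h0 : ∀ y, R ≤ y → ∀ x, y ≤ x → 0 ≤ q x := fun y hy x hx =>
    zero_le_one.trans (h1 x (hy.trans hx))
  obtain ⟨c, c', hc, hc0, hc1⟩ := exists_isSol hq R 1 0
  obtain ⟨s, s', hs, hs0, hs1⟩ := exists_isSol hq R 0 1
  have hw : ∀ x, c x * s' x - c' x * s x = 1 := fun x => by
    have := hc.wronskian_eq hs x R
    rw [hc0, hc1, hs0, hs1] at this; linarith
  have hs' : ∀ x, R ≤ x → 1 ≤ s' x := fun x hx => by
    have := (hs.nonneg (h0 R le_rfl) hs0.ge (by simp [hs1]) (Or.inr (by simp [hs1])) hx).2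
    rwa [hs1] at this
  have hspos : ∀ x, R < x → 0 < s x := fun x hx => by
    have := le_of_deriv_nonneg (fun y => (hs.left y).sub (hasDerivAt_id y))
      (fun y hy => sub_nonneg.2 (hs' y hy.1)) hx.le
    simp only [Pi.sub_apply, id, hs0] at this
    linarith
  have hA : ∀ x z, R ≤ x → x ≤ z → c' x / s' x ≤ c' z / s' z := by
    intro x z hx hz
    have p1 := hs' x hx
    have p2 := hs' z (hx.trans hz)
    -- This combination has value `1` and slope `0` at `x`, so its slope stays nonnegative to the
    -- right.
    have hsol := (hc.const_mul (s' x)).sub (hs.const_mul (c' x))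
    have := (hsol.nonneg (h0 x hx) (by have := hw x; linarith) (by linarith)
      (Or.inl (by have := hw x; linarith)) hz).2
    rw [div_le_div_iff₀ (by linarith) (by linarith)]
    linarith
  have hB : ∀ y z, R < y → y ≤ z → c z / s z ≤ c y / s y := by
    intro y z hy hz
    have p1 := hspos y hy
    have p2 := hspos z (hy.trans_le hz)
    -- This combination has value `0` and slope `1` at `y`, so it stays nonnegative to the right.
    have hsol := (hs.const_mul (c y)).sub (hc.const_mul (s y))
    have := (hsol.nonneg (h0 y hy.le) (by linarith) (by have := hw y; linarith)
      (Or.inr (by have := hw y; linarith)) hz).1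
    rw [div_le_div_iff₀ p2 p1]
    linarith
  have hAB : ∀ x y, R ≤ x → R < y → c' x / s' x ≤ c y / s y := by
    intro x y hx hy
    have hz : R < max x y := lt_max_of_lt_right hy
    refine (hA x (max x y) hx (le_max_left _ _)).trans
      (le_trans ?_ (hB y (max x y) hy (le_max_right _ _)))
    rw [div_le_div_iff₀ (by linarith [hs' _ hz.le]) (hspos _ hz)]
    linarith [hw (max x y)]
  set A : Set ℝ := (fun x => c' x / s' x) '' Ici R
  set t := sSup A
  have hbdd : BddAbove A := ⟨c (R + 1) / s (R + 1), by
    rintro _ ⟨x, hx, rfl⟩; exact hAB x _ hx (by linarith)⟩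
  have hle : ∀ x, R ≤ x → c' x - t * s' x ≤ 0 := fun x hx => by
    have : c' x / s' x ≤ t := le_csSup hbdd ⟨x, hx, rfl⟩
    rw [div_le_iff₀ (by linarith [hs' x hx])] at this
    linarith
  have hge : ∀ x, R ≤ x → 0 ≤ c x - t * s x := by
    intro x hx
    rcases hx.eq_or_lt with rfl | hx
    · simp [hc0, hs0]
    · have : t ≤ c x / s x := csSup_le ⟨_, R, self_mem_Ici, rfl⟩ (by
        rintro _ ⟨y, hy, rfl⟩; exact hAB y x hy hx)
      rw [le_div_iff₀ (hspos x hx)] at this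
      linarith
  have hsol := hc.sub (hs.const_mul t)
  -- Strict positivity: a nonnegative nonincreasing solution that vanishes at `x` vanishes beyond
  -- `x`, hence everywhere, contradicting the value `1` at `R`.
  refine ⟨_, _, hsol, by simp [hc0, hs0], fun x hx => (hge x hx).lt_of_ne fun hx0 => ?_, hle⟩
  have hz : ∀ y, x ≤ y → c y - t * s y = 0 := fun y hy =>
    le_antisymm (by
      rw [hx0]
      exact le_of_deriv_nonpos hsol.left (fun z hz => hle z (hx.trans hz.1)) hy)
      (hge y (hx.trans hy))
  have hd : c' (x + 1) - t * s' (x + 1) = 0 :=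
    (hsol.left (x + 1)).unique <| (hasDerivAt_const (x + 1) (0 : ℝ)).congr_of_eventuallyEq <| by
      filter_upwards [Ioi_mem_nhds (show x < x + 1 by linarith)] with y hy
      exact hz y (le_of_lt hy)
  have := (hsol.eq_zero hq (hz (x + 1) (by linarith)) hd R).1
  simp [hc0, hs0] at this

section Decay

variable {q u v : ℝ → ℝ} {R : ℝ}

/-- For `q ≥ 1` and `u > 0` the function `(u + v) e^{-y}` is nondecreasing. If `u + v` were positive
at one point it would grow exponentially, but `u + v ≤ u ≤ 1`. -/
theorem IsWeyl.le_neg (h : IsWeyl q R u v) (h1 : ∀ x, R ≤ x → 1 ≤ q x) {x : ℝ} (hx : R ≤ x) :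
    v x ≤ -u x := by
  by_contra! hlt
  have hz : 0 < u x + v x := by linarith
  have hd : ∀ y, HasDerivAt (fun y => (u y + v y) * Real.exp (-y))
      ((q y - 1) * u y * Real.exp (-y)) y := fun y =>
    (((h.isSol.left y).add (h.isSol.right y)).mul (hasDerivAt_neg y).exp).congr_deriv
      (by simp only [Pi.add_apply]; ring)
  have hbound : ∀ y, x ≤ y → (u x + v x) * (1 + (y - x)) ≤ 1 := by
    intro y hy
    have e1 := le_of_deriv_nonneg hd (fun z hz => mul_nonneg (mul_nonneg
      (by linarith [h1 z (hx.trans hz.1)]) (h.pos z (hx.trans hz.1)).le) (Real.exp_pos _).le) hy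
    have e2 : (u x + v x) * Real.exp (y - x) ≤ u y + v y := by
      have := mul_le_mul_of_nonneg_right e1 (Real.exp_pos y).le
      rwa [mul_assoc, mul_assoc, ← Real.exp_add, ← Real.exp_add, neg_add_cancel, Real.exp_zero,
        mul_one, neg_add_eq_sub] at this
    have e3 : u y ≤ 1 := by
      rw [← h.normalized]
      exact le_of_deriv_nonpos h.isSol.left (fun z hz => h.nonpos z hz.1) (hx.trans hy)
    have e4 := h.nonpos y (hx.trans hy)
    have e5 := mul_le_mul_of_nonneg_left (Real.add_one_le_exp (y - x)) hz.le
    linarith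
  have := hbound (x + 1 / (u x + v x)) (by have := one_div_pos.2 hz; linarith)
  rw [add_sub_cancel_left, mul_add, mul_one_div_cancel hz.ne'] at this
  linarith

theorem IsWeyl.le_exp (h : IsWeyl q R u v) (h1 : ∀ x, R ≤ x → 1 ≤ q x) {x : ℝ} (hx : R ≤ x) :
    u x ≤ Real.exp (R - x) := by
  have hd : ∀ y, HasDerivAt (fun y => u y * Real.exp y) ((v y + u y) * Real.exp y) y := fun y =>
    ((h.isSol.left y).mul (Real.hasDerivAt_exp y)).congr_deriv (by ring)
  have := le_of_deriv_nonpos hd (fun z hz => mul_nonpos_of_nonpos_of_nonneg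
    (by linarith [h.le_neg h1 hz.1]) (Real.exp_pos _).le) hx
  rw [h.normalized, one_mul] at this
  rw [Real.exp_sub, le_div_iff₀ (Real.exp_pos x)]
  exact this

theorem tendsto_exp_sub (R : ℝ) : Tendsto (fun x : ℝ => Real.exp (R - x)) atTop (𝓝 0) :=
  Real.tendsto_exp_atBot.comp (tendsto_atBot_add_const_left atTop R tendsto_neg_atTop_atBot)

theorem IsWeyl.tendsto_left (h : IsWeyl q R u v) (h1 : ∀ x, R ≤ x → 1 ≤ q x) :
    Tendsto u atTop (𝓝 0) :=
  squeeze_zero' (eventually_atTop.2 ⟨R, fun x hx => (h.pos x hx).le⟩)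
    (eventually_atTop.2 ⟨R, fun _ hx => h.le_exp h1 hx⟩) (tendsto_exp_sub R)

/-- `u` is convex, so `-v x ≤ u (x - 1) - u x ≤ u (x - 1)`, and the decay of `u` transfers to `v`
with a shift by one. -/
theorem IsWeyl.neg_le_exp (h : IsWeyl q R u v) (h1 : ∀ x, R ≤ x → 1 ≤ q x) {x : ℝ}
    (hx : R + 1 ≤ x) : -v x ≤ Real.exp (R + 1 - x) := by
  have hd : ∀ y, HasDerivAt (fun y => u y - v x * y) (v y - v x) y := fun y =>
    ((h.isSol.left y).sub ((hasDerivAt_id y).const_mul (v x))).congr_deriv (by simp)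
  have hmono : ∀ y, R ≤ y → y ≤ x → v y ≤ v x := fun y hy hyx =>
    le_of_deriv_nonneg h.isSol.right (fun z hz => by
      have := h1 z (hy.trans hz.1); have := h.pos z (hy.trans hz.1); positivity) hyx
  have e1 := le_of_deriv_nonpos hd (a := x - 1) (b := x)
    (fun y hy => by linarith [hmono y (by linarith [hy.1]) hy.2]) (by linarith)
  have e2 := h.le_exp h1 (x := x - 1) (by linarith)
  have e3 := h.pos x (by linarith)
  rw [show R - (x - 1) = R + 1 - x by ring] at e2
  linarith

theorem IsWeyl.tendsto_right (h : IsWeyl q R u v) (h1 : ∀ x, R ≤ x → 1 ≤ q x) :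
    Tendsto v atTop (𝓝 0) := by
  have : Tendsto (fun x => -v x) atTop (𝓝 0) :=
    squeeze_zero' (eventually_atTop.2 ⟨R, fun x hx => neg_nonneg.2 (h.nonpos x hx)⟩)
      (eventually_atTop.2 ⟨R + 1, fun _ hx => h.neg_le_exp h1 hx⟩) (tendsto_exp_sub (R + 1))
  simpa using this.neg

end Decay

/-! ### Dependence of the decaying solution on the potential. -/

section Compare

variable {q₁ q₂ u₁ v₁ u₂ v₂ : ℝ → ℝ} {R : ℝ}

/-- The Wronskian tends to `0` at infinity, and subtracting `A e^{R - x}` makes it nondecreasing on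
`[a, ∞)`; hence the difference is at most `0` at `a`. At `a = R` the Wronskian is the difference of
the slopes. -/
theorem IsWeyl.sub_le (h₁ : IsWeyl q₁ R u₁ v₁) (h₂ : IsWeyl q₂ R u₂ v₂)
    (hq₁ : ∀ x, R ≤ x → 1 ≤ q₁ x) (hq₂ : ∀ x, R ≤ x → 1 ≤ q₂ x) {A : ℝ} {a : ℝ}
    (hA : ∀ x, a ≤ x → -(A * Real.exp (R - x)) ≤ (q₁ x - q₂ x) * (u₁ x * u₂ x)) :
    v₁ a * u₂ a - u₁ a * v₂ a ≤ A * Real.exp (R - a) := by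
  have hd : ∀ x, HasDerivAt (fun x => (v₁ x * u₂ x - u₁ x * v₂ x) - A * Real.exp (R - x))
      ((q₁ x - q₂ x) * (u₁ x * u₂ x) + A * Real.exp (R - x)) x := fun x =>
    ((h₁.isSol.hasDerivAt_wronskian h₂.isSol x).sub
      (((hasDerivAt_id x).const_sub R).exp.const_mul A)).congr_deriv (by simp)
  have hlim : Tendsto (fun x => (v₁ x * u₂ x - u₁ x * v₂ x) - A * Real.exp (R - x)) atTop
      (𝓝 0) := by
    have := (((h₁.tendsto_right hq₁).mul (h₂.tendsto_left hq₂)).sub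
      ((h₁.tendsto_left hq₁).mul (h₂.tendsto_right hq₂))).sub ((tendsto_exp_sub R).const_mul A)
    simpa using this
  have := ge_of_tendsto hlim (eventually_atTop.2 ⟨a, fun x hx =>
    le_of_deriv_nonneg hd (fun y hy => by linarith [hA y hy.1]) hx⟩)
  linarith

theorem IsWeyl.slope_strictAnti (h₁ : IsWeyl q₁ R u₁ v₁) (h₂ : IsWeyl q₂ R u₂ v₂)
    (hq₁ : ∀ x, R ≤ x → 1 ≤ q₁ x) (hq₂ : ∀ x, R ≤ x → 1 ≤ q₂ x)
    (h : ∀ x, R ≤ x → q₂ x < q₁ x) : v₁ R < v₂ R := by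
  have e1 := h₁.sub_le h₂ hq₁ hq₂ (A := 0) (a := R + 1) fun x hx => by
    have := h₁.pos x (by linarith)
    have := h₂.pos x (by linarith)
    have := sub_pos.2 (h x (by linarith))
    rw [zero_mul, neg_zero]
    positivity
  have hd := h₁.isSol.hasDerivAt_wronskian h₂.isSol
  have e2 := strictMonoOn_of_deriv_pos (convex_Ici R)
    (fun x _ => (hd x).continuousAt.continuousWithinAt) (fun x hx => by
      have hx := interior_subset hx
      have := h₁.pos x hx
      have := h₂.pos x hx
      have := sub_pos.2 (h x hx)
      rw [(hd x).deriv]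
      positivity) (mem_Ici.2 le_rfl) (mem_Ici.2 (show R ≤ R + 1 by linarith)) (by linarith)
  simp only [h₁.normalized, h₂.normalized] at e2
  linarith

/-- The product `u₁ u₂` decays like `e^{2(R - x)}`: one factor absorbs the linear weight `1 + |x|`,
the other supplies the decay needed in `IsWeyl.sub_le`. -/
theorem IsWeyl.abs_slope_sub_le (h₁ : IsWeyl q₁ R u₁ v₁) (h₂ : IsWeyl q₂ R u₂ v₂)
    (hR : 0 ≤ R) (hq₁ : ∀ x, R ≤ x → 1 ≤ q₁ x) (hq₂ : ∀ x, R ≤ x → 1 ≤ q₂ x) {δ : ℝ}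
    (hδ : 0 ≤ δ) (h : ∀ x, |q₁ x - q₂ x| ≤ δ * (1 + |x|)) :
    |v₁ R - v₂ R| ≤ δ * (1 + R) := by
  have key : ∀ x, R ≤ x →
      |(q₁ x - q₂ x) * (u₁ x * u₂ x)| ≤ δ * (1 + R) * Real.exp (R - x) := by
    intro x hx
    have p1 := h₁.pos x hx
    have p2 := h₂.pos x hx
    rw [abs_mul, abs_of_pos (mul_pos p1 p2)]
    have e1 : u₁ x * u₂ x ≤ Real.exp (R - x) * Real.exp (R - x) :=
      mul_le_mul (h₁.le_exp hq₁ hx) (h₂.le_exp hq₂ hx) p2.le (Real.exp_pos _).le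
    have e2 : 1 + |x| ≤ (1 + R) * Real.exp (x - R) := by
      rw [abs_of_nonneg (hR.trans hx)]
      have := Real.add_one_le_exp (x - R)
      nlinarith
    calc |q₁ x - q₂ x| * (u₁ x * u₂ x)
        ≤ (δ * ((1 + R) * Real.exp (x - R))) * (Real.exp (R - x) * Real.exp (R - x)) := by
          refine mul_le_mul ((h x).trans ?_) e1 (mul_pos p1 p2).le (by positivity)
          gcongr
      _ = δ * (1 + R) * (Real.exp (x - R) * Real.exp (R - x)) * Real.exp (R - x) := by ring
      _ = _ := by rw [← Real.exp_add]; simp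
  have e1 := h₁.sub_le h₂ hq₁ hq₂ (a := R) (fun x hx => (abs_le.1 (key x hx)).1)
  have e2 := h₂.sub_le h₁ hq₂ hq₁ (A := δ * (1 + R)) (a := R) (fun x hx => by
    have := (abs_le.1 (key x hx)).2
    linarith)
  rw [h₁.normalized, h₂.normalized, sub_self, Real.exp_zero] at e1 e2
  exact abs_le.2 ⟨by linarith, by linarith⟩

/-- Since `q ≥ 1`, `g g'` is nondecreasing. If it were positive somewhere, `g²` would stay above a
positive constant and not be integrable. So `g g' ≤ 0`, both `g` and `g'` are bounded, and the
constant Wronskian with the decaying solution has limit `0`. -/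
theorem IsWeyl.wronskian_eq_zero (h : IsWeyl q₁ R u₁ v₁) (hq : ∀ x, R ≤ x → 1 ≤ q₁ x)
    {g g' : ℝ → ℝ} (hg : IsSol q₁ g g') (hint : IntegrableOn (fun x => g x ^ 2) (Ioi R)) :
    g' R = v₁ R * g R := by
  have hmono : ∀ x y, R ≤ x → x ≤ y → g x * g' x ≤ g y * g' y := fun x y hx hxy =>
    le_of_deriv_nonneg hg.hasDerivAt_mul (fun z hz => by
      have := hq z (hx.trans hz.1); positivity) hxy
  have hneg : ∀ x, R ≤ x → g x * g' x ≤ 0 := by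
    intro x hx
    by_contra! hpos
    have hge : ∀ y, x ≤ y → g x ^ 2 ≤ g y ^ 2 := fun y hy =>
      le_of_deriv_nonneg hg.hasDerivAt_sq_left (fun z hz => by
        have := hmono x z hx hz.1; linarith) hy
    have hgx : 0 < g x ^ 2 := by
      have : g x ≠ 0 := fun h0 => by simp [h0] at hpos
      positivity
    have hi : IntegrableOn (fun _ : ℝ => g x ^ 2) (Ioi x) :=
      (hint.mono_set (Ioi_subset_Ioi hx)).mono' aestronglyMeasurable_const
        ((ae_restrict_mem measurableSet_Ioi).mono fun y hy => by
          rw [Real.norm_of_nonneg hgx.le]; exact hge y (le_of_lt hy))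
    rw [integrableOn_const_iff] at hi
    simp at hi
    simp [hi] at hpos
  have hb1 : ∀ x, R ≤ x → |g x| ≤ |g R| := fun x hx => sq_le_sq.1
    (le_of_deriv_nonpos hg.hasDerivAt_sq_left (fun z hz => by linarith [hneg z hz.1]) hx)
  have hb2 : ∀ x, R ≤ x → |g' x| ≤ |g' R| := fun x hx => sq_le_sq.1
    (le_of_deriv_nonpos hg.hasDerivAt_sq_right (fun z hz =>
      mul_nonpos_of_nonneg_of_nonpos (by linarith [hq z hz.1]) (hneg z hz.1)) hx)
  have hlim : Tendsto (fun x => |g' R| * |u₁ x| + |g R| * |v₁ x|) atTop (𝓝 0) := by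
    simpa using ((h.tendsto_left hq).abs.const_mul |g' R|).add
      ((h.tendsto_right hq).abs.const_mul |g R|)
  have hle : |g' R * u₁ R - g R * v₁ R| ≤ 0 :=
    ge_of_tendsto hlim (eventually_atTop.2 ⟨R, fun x hx => by
      rw [hg.wronskian_eq h.isSol R x]
      refine (abs_sub _ _).trans ?_
      rw [abs_mul, abs_mul]
      exact add_le_add (mul_le_mul_of_nonneg_right (hb2 x hx) (abs_nonneg _))
        (mul_le_mul_of_nonneg_right (hb1 x hx) (abs_nonneg _))⟩)
  have := abs_nonpos_iff.1 hle
  rw [h.normalized] at this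
  linarith

end Compare

/-! ### The mismatch angle: eigenvalue condition, bounds, monotonicity, continuity. -/

/-- `q` is continuous and at least `1` outside `(-R, R)`. -/
structure IsConfining (q : ℝ → ℝ) (R : ℝ) : Prop where
  continuous : Continuous q
  one_le : 1 ≤ R
  one_le_apply : ∀ x, R ≤ |x| → 1 ≤ q x

theorem IsConfining.reflect {q : ℝ → ℝ} {R : ℝ} (h : IsConfining q R) :
    IsConfining (fun x => q (-x)) R :=
  ⟨h.continuous.comp continuous_neg, h.one_le, fun x hx => h.one_le_apply _ (by rwa [abs_neg])⟩

theorem IsConfining.right {q : ℝ → ℝ} {R : ℝ} (h : IsConfining q R) (x : ℝ) (hx : R ≤ x) :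
    1 ≤ q x :=
  h.one_le_apply x (hx.trans (le_abs_self x))

/-- The solution decaying at `+∞`, together with its derivative. -/
def weyl (q : ℝ → ℝ) (R : ℝ) : (ℝ → ℝ) × (ℝ → ℝ) :=
  Classical.epsilon fun p => IsWeyl q R p.1 p.2

/-- Minus the logarithmic derivative at `R` of the solution decaying at `+∞`. -/
def weylSlope (q : ℝ → ℝ) (R : ℝ) : ℝ := -(weyl q R).2 R

/-- The logarithmic derivative at `-R` of the solution decaying at `-∞`. -/
def leftSlope (q : ℝ → ℝ) (R : ℝ) : ℝ := weylSlope (fun x => q (-x)) R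

/-- The Prüfer angle of the solution decaying at `-∞`. -/
def leftAngle (q : ℝ → ℝ) (R : ℝ) : ℝ → ℝ :=
  Classical.epsilon fun θ => θ (-R) = Real.pi / 2 - Real.arctan (leftSlope q R) ∧ IsPrufer q θ

/-- The solution decaying at `-∞`, together with its derivative. -/
def leftSol (q : ℝ → ℝ) (R : ℝ) : (ℝ → ℝ) × (ℝ → ℝ) :=
  Classical.epsilon fun p => IsSol q p.1 p.2 ∧ p.1 (-R) = 1 ∧ p.2 (-R) = leftSlope q R

/-- The difference at `R` between the Prüfer angles of the solutions decaying at `-∞` and `+∞`. -/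
def mismatch (q : ℝ → ℝ) (R : ℝ) : ℝ :=
  leftAngle q R R - Real.pi / 2 - Real.arctan (weylSlope q R)

section

variable {q : ℝ → ℝ} {R : ℝ}

theorem IsConfining.isWeyl (h : IsConfining q R) : IsWeyl q R (weyl q R).1 (weyl q R).2 := by
  obtain ⟨u, v, huv⟩ := exists_isWeyl h.continuous h.right
  exact Classical.epsilon_spec (p := fun p : (ℝ → ℝ) × (ℝ → ℝ) => IsWeyl q R p.1 p.2)
    ⟨(u, v), huv⟩

theorem IsConfining.one_le_weylSlope (h : IsConfining q R) : 1 ≤ weylSlope q R := by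
  have := h.isWeyl.le_neg h.right le_rfl
  rw [h.isWeyl.normalized] at this
  rw [weylSlope]; linarith

theorem IsConfining.one_le_leftSlope (h : IsConfining q R) : 1 ≤ leftSlope q R :=
  h.reflect.one_le_weylSlope

theorem IsConfining.leftAngle_spec (h : IsConfining q R) :
    leftAngle q R (-R) = Real.pi / 2 - Real.arctan (leftSlope q R) ∧ IsPrufer q (leftAngle q R) :=
  Classical.epsilon_spec (p := fun θ : ℝ → ℝ =>
    θ (-R) = Real.pi / 2 - Real.arctan (leftSlope q R) ∧ IsPrufer q θ)
    (exists_prufer h.continuous _ _)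

theorem IsConfining.leftSol_spec (h : IsConfining q R) :
    IsSol q (leftSol q R).1 (leftSol q R).2 ∧ (leftSol q R).1 (-R) = 1 ∧
      (leftSol q R).2 (-R) = leftSlope q R := by
  obtain ⟨u, v, huv⟩ := exists_isSol h.continuous (-R) 1 (leftSlope q R)
  exact Classical.epsilon_spec (p := fun p : (ℝ → ℝ) × (ℝ → ℝ) =>
    IsSol q p.1 p.2 ∧ p.1 (-R) = 1 ∧ p.2 (-R) = leftSlope q R) ⟨(u, v), huv⟩

theorem IsConfining.isSol (h : IsConfining q R) : IsSol q (leftSol q R).1 (leftSol q R).2 :=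
  h.leftSol_spec.1

theorem sin_arctan_eq (t : ℝ) : Real.sin (Real.arctan t) = t * Real.cos (Real.arctan t) := by
  rw [Real.sin_arctan, Real.cos_arctan]; ring

theorem IsConfining.leftSol_eq_weyl (h : IsConfining q R) :
    (leftSol q R).1 = (fun x => (weyl (fun x => q (-x)) R).1 (-x)) ∧
      (leftSol q R).2 = fun x => -(weyl (fun x => q (-x)) R).2 (-x) := by
  have hs := h.reflect.isWeyl.isSol.reflect
  simp only [neg_neg] at hs
  refine h.isSol.unique h.continuous hs (x₀ := -R) ?_ ?_
  · rw [h.leftSol_spec.2.1, neg_neg, h.reflect.isWeyl.normalized]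
  · rw [h.leftSol_spec.2.2, neg_neg]; rfl

/-- The solution decaying at `+∞` has angle `π/2 + arctan (weylSlope q R)` at `R`. The sine of the
angle difference is, up to nonzero factors, the Wronskian at `R` of the two decaying solutions. -/
theorem IsConfining.mismatch_eq_iff (h : IsConfining q R) :
    (∃ n : ℤ, mismatch q R = n * Real.pi) ↔
      (leftSol q R).2 R = -weylSlope q R * (leftSol q R).1 R := by
  obtain ⟨hθ0, hθ⟩ := h.leftAngle_spec
  obtain ⟨hs, hs0, hs1⟩ := h.leftSol_spec
  obtain ⟨r, hr, hr0, hsol⟩ := hθ.exists_isSol h.continuous (-R)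
  have hc : 0 < Real.cos (Real.arctan (leftSlope q R)) := Real.cos_arctan_pos _
  obtain ⟨e1, e2⟩ := hsol.unique h.continuous
    (hs.const_mul (Real.cos (Real.arctan (leftSlope q R)))) (x₀ := -R)
    (by rw [hr0, hs0, hθ0, Real.sin_pi_div_two_sub]; ring)
    (by rw [hr0, hs1, hθ0, Real.cos_pi_div_two_sub, sin_arctan_eq]; ring)
  have e1 := congrFun e1 R
  have e2 := congrFun e2 R
  have key : Real.sin (mismatch q R) = -(Real.cos (Real.arctan (weylSlope q R)) *
      (Real.cos (leftAngle q R R) + weylSlope q R * Real.sin (leftAngle q R R))) := by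
    rw [mismatch, sub_right_comm, Real.sin_sub_pi_div_two, Real.cos_sub, sin_arctan_eq]
    ring
  have hc' := Real.cos_arctan_pos (weylSlope q R)
  calc (∃ n : ℤ, mismatch q R = n * Real.pi) ↔ Real.sin (mismatch q R) = 0 := by
        rw [Real.sin_eq_zero_iff]; simp only [eq_comm]
    _ ↔ Real.cos (leftAngle q R R) + weylSlope q R * Real.sin (leftAngle q R R) = 0 := by
        rw [key, neg_eq_zero, mul_eq_zero, or_iff_right hc'.ne']
    _ ↔ r R * (Real.cos (leftAngle q R R) + weylSlope q R * Real.sin (leftAngle q R R)) = 0 := by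
        rw [mul_eq_zero, or_iff_right (hr R).ne']
    _ ↔ Real.cos (Real.arctan (leftSlope q R)) *
          ((leftSol q R).2 R + weylSlope q R * (leftSol q R).1 R) = 0 := by
        rw [show r R * (Real.cos (leftAngle q R R) + weylSlope q R * Real.sin (leftAngle q R R)) =
          r R * Real.cos (leftAngle q R R) + weylSlope q R * (r R * Real.sin (leftAngle q R R)) by
            ring, e1, e2]
        ring_nf
    _ ↔ _ := by
        rw [mul_eq_zero, or_iff_right hc.ne']
        constructor <;> intro h <;> linarith

theorem IsConfining.leftAngle_nonneg (h : IsConfining q R) {x : ℝ} (hx : -R ≤ x) :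
    0 ≤ leftAngle q R x := by
  obtain ⟨hθ0, hθ⟩ := h.leftAngle_spec
  have := hθ.int_mul_pi_le h.continuous 0 hx
    (by rw [hθ0]; simp [(Real.arctan_lt_pi_div_two _).le])
  simpa using this

/-- The left angle starts in `(0, π/2)` and cannot cross `0` downwards. This bound excludes the
negative multiples of `π`, so that counting starts at `0`. -/
theorem IsConfining.neg_pi_lt_mismatch (h : IsConfining q R) : -Real.pi < mismatch q R := by
  have := h.leftAngle_nonneg (x := R) (by linarith [h.one_le])
  have := Real.arctan_lt_pi_div_two (weylSlope q R)
  rw [mismatch]; linarith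

/-- For `q ≥ 0` the constant angle `π/2` is a supersolution, and both arctangents are positive. -/
theorem IsConfining.mismatch_neg (h : IsConfining q R) (hq : ∀ x, 0 ≤ q x) :
    mismatch q R < 0 := by
  obtain ⟨hθ0, hθ⟩ := h.leftAngle_spec
  have h1 : 0 < Real.arctan (leftSlope q R) :=
    Real.arctan_pos.2 (by linarith [h.one_le_leftSlope])
  have h2 : 0 < Real.arctan (weylSlope q R) :=
    Real.arctan_pos.2 (by linarith [h.one_le_weylSlope])
  have := hθ.le_of_super h.continuous (fun x => hasDerivAt_const x (Real.pi / 2))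
    (fun x => by simp [pruferField, hq x]) (a := -R) (b := R) (by linarith [h.one_le])
    (by rw [hθ0]; linarith)
  rw [mismatch]; linarith

/-- Lowering `q` raises the initial left angle, speeds up the rotation and lowers the right slope;
the three effects add up, the last one strictly. -/
theorem mismatch_lt_mismatch {q₁ q₂ : ℝ → ℝ} (h₁ : IsConfining q₁ R) (h₂ : IsConfining q₂ R)
    (h : ∀ x, q₂ x < q₁ x) : mismatch q₁ R < mismatch q₂ R := by
  have e1 : weylSlope q₂ R < weylSlope q₁ R :=
    neg_lt_neg (h₁.isWeyl.slope_strictAnti h₂.isWeyl h₁.right h₂.right fun x _ => h x)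
  have e2 : leftSlope q₂ R < leftSlope q₁ R :=
    neg_lt_neg (h₁.reflect.isWeyl.slope_strictAnti h₂.reflect.isWeyl h₁.reflect.right
      h₂.reflect.right fun x _ => h (-x))
  have e3 := h₁.leftAngle_spec.2.mono h₂.continuous h₂.leftAngle_spec.2 (fun x => (h x).le)
    (a := -R) (b := R) (by linarith [h₁.one_le]) (by
      rw [h₁.leftAngle_spec.1, h₂.leftAngle_spec.1]
      linarith [Real.arctan_strictMono e2])
  have := Real.arctan_strictMono e1
  rw [mismatch, mismatch]; linarith

theorem abs_arctan_sub_le (a b : ℝ) : |Real.arctan a - Real.arctan b| ≤ |a - b| := by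
  have := Convex.norm_image_sub_le_of_norm_deriv_le (f := Real.arctan) (C := 1) (s := univ)
    (fun x _ => Real.differentiable_arctan x) (fun x _ => by
      rw [Real.deriv_arctan, Real.norm_eq_abs, abs_of_pos (by positivity)]
      exact div_le_one_of_le₀ (by nlinarith [sq_nonneg x]) (by positivity)) convex_univ
    (mem_univ b) (mem_univ a)
  simpa using this

theorem gronwallBound_smul {K : ℝ} (hK : K ≠ 0) (δ a b x : ℝ) :
    gronwallBound (δ * a) K (δ * b) x = δ * gronwallBound a K b x := by
  rw [gronwallBound_of_K_ne_0 hK, gronwallBound_of_K_ne_0 hK]; ring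

theorem abs_slope_sub_le {q₁ q₂ : ℝ → ℝ} (h₁ : IsConfining q₁ R) (h₂ : IsConfining q₂ R) {δ : ℝ}
    (hδ : 0 ≤ δ) (h : ∀ x, |q₁ x - q₂ x| ≤ δ * (1 + |x|)) :
    |weylSlope q₁ R - weylSlope q₂ R| ≤ δ * (1 + R) ∧
      |leftSlope q₁ R - leftSlope q₂ R| ≤ δ * (1 + R) := by
  have hR : 0 ≤ R := by linarith [h₁.one_le]
  constructor
  · rw [weylSlope, weylSlope, neg_sub_neg, abs_sub_comm]
    exact h₁.isWeyl.abs_slope_sub_le h₂.isWeyl hR h₁.right h₂.right hδ h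
  · rw [leftSlope, leftSlope, weylSlope, weylSlope, neg_sub_neg, abs_sub_comm]
    exact h₁.reflect.isWeyl.abs_slope_sub_le h₂.reflect.isWeyl hR h₁.reflect.right
      h₂.reflect.right hδ fun x => by simpa using h (-x)

/-- The slopes at `±R` move by at most `δ (1 + R)`, and Gronwall carries the left error across `[-R,
R]`. The weight `1 + |x|` is the one for which varying `k` is a small perturbation of `(k - β)²`. -/
theorem IsConfining.exists_abs_mismatch_sub_le {q₁ : ℝ → ℝ} (h₁ : IsConfining q₁ R) :
    ∃ C, 0 ≤ C ∧ ∀ (q₂ : ℝ → ℝ) (δ : ℝ), IsConfining q₂ R → 0 ≤ δ →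
      (∀ x, |q₁ x - q₂ x| ≤ δ * (1 + |x|)) → |mismatch q₁ R - mismatch q₂ R| ≤ C * δ := by
  obtain ⟨Q, hQ0, hQ⟩ := exists_abs_le h₁.continuous (-R) R
  have hR : 1 ≤ R := h₁.one_le
  set B := gronwallBound (1 + R) (1 + Q) (1 + R) (R - -R)
  have hB : 0 ≤ B := by
    simp only [B]
    rw [gronwallBound_of_K_ne_0 (by linarith)]
    have : 1 ≤ Real.exp ((1 + Q) * (R - -R)) :=
      Real.one_le_exp (mul_nonneg (by linarith) (by linarith))
    have : 0 ≤ (1 + R) / (1 + Q) * (Real.exp ((1 + Q) * (R - -R)) - 1) :=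
      mul_nonneg (by positivity) (by linarith)
    positivity
  refine ⟨B + (1 + R), by linarith, fun q₂ δ h₂ hδ h => ?_⟩
  obtain ⟨e1, e2⟩ := abs_slope_sub_le h₁ h₂ hδ h
  have e3 := h₁.leftAngle_spec.2.abs_sub_le h₂.leftAngle_spec.2 (a := -R) (b := R)
    (G := δ * (1 + R)) (δ := δ * (1 + R)) (by linarith) hQ
    (fun x hx => (h x).trans (by have := abs_le.2 hx; gcongr)) (by
      rw [h₁.leftAngle_spec.1, h₂.leftAngle_spec.1, sub_sub_sub_cancel_left, abs_sub_comm]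
      exact (abs_arctan_sub_le _ _).trans e2)
  rw [gronwallBound_smul (by linarith)] at e3
  have e4 := (abs_arctan_sub_le (weylSlope q₁ R) (weylSlope q₂ R)).trans e1
  have e5 : mismatch q₁ R - mismatch q₂ R = (leftAngle q₁ R R - leftAngle q₂ R R) -
      (Real.arctan (weylSlope q₁ R) - Real.arctan (weylSlope q₂ R)) := by
    rw [mismatch, mismatch]; ring
  rw [e5]
  refine (abs_sub _ _).trans ?_
  linarith

end

/-! ### Growth of the mismatch with the energy. -/

section Growth

theorem ae_sin_ne_zero : ∀ᵐ x : ℝ, Real.sin x ≠ 0 := by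
  have : {x : ℝ | Real.sin x = 0}.Countable := by
    refine (countable_range fun n : ℤ => (n : ℝ) * Real.pi).mono fun x hx => ?_
    obtain ⟨n, hn⟩ := Real.sin_eq_zero_iff.1 hx
    exact ⟨n, hn⟩
  filter_upwards [this.ae_notMem volume] with x hx using hx

theorem one_le_cos_sq_add {κ : ℝ} (hκ : 1 ≤ κ) (s : ℝ) :
    1 ≤ Real.cos s ^ 2 + κ * Real.sin s ^ 2 := by
  nlinarith [Real.sin_sq_add_cos_sq s, sq_nonneg (Real.sin s)]

theorem tendsto_integral_inv_cos_sq_add (L : ℝ) :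
    Tendsto (fun κ : ℝ => ∫ s in (0 : ℝ)..L, (Real.cos s ^ 2 + κ * Real.sin s ^ 2)⁻¹) atTop
      (𝓝 0) := by
  have h := intervalIntegral.tendsto_integral_filter_of_dominated_convergence
    (μ := volume) (a := 0) (b := L) (l := (atTop : Filter ℝ))
    (F := fun κ s => (Real.cos s ^ 2 + κ * Real.sin s ^ 2)⁻¹) (f := fun _ => (0 : ℝ))
    (fun _ => 1) (Eventually.of_forall fun κ => by
      refine Measurable.aestronglyMeasurable ?_
      fun_prop)
    (by
      filter_upwards [eventually_ge_atTop 1] with κ hκ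
      refine Eventually.of_forall fun s _ => ?_
      have := one_le_cos_sq_add hκ s
      rw [Real.norm_of_nonneg (by positivity)]
      exact inv_le_one_of_one_le₀ this)
    intervalIntegrable_const
    (by
      filter_upwards [ae_sin_ne_zero] with s hs _
      have hs : 0 < Real.sin s ^ 2 := by positivity
      exact (tendsto_atTop_add_const_left _ _
        (tendsto_id.atTop_mul_const hs)).inv_tendsto_atTop)
  simpa using h

/-- Strongly attractive potentials make Prüfer angles rotate fast. -/
theorem exists_prufer_ge (L : ℝ) : ∃ κ : ℝ, ∀ (q θ : ℝ → ℝ), IsPrufer q θ → 0 ≤ θ 0 →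
    (∀ x ∈ Icc (0 : ℝ) 1, q x ≤ -κ) → L ≤ θ 1 := by
  -- The integral is the time that `θ' = cos² θ + κ sin² θ` needs to go from `0` to `L`; `κ` is
  -- chosen so that it is below `1`.
  obtain ⟨κ, hκ, hκ1⟩ := ((tendsto_integral_inv_cos_sq_add L).eventually_lt_const
    (show (0 : ℝ) < 1 by norm_num)).and (eventually_ge_atTop (1 : ℝ)) |>.exists
  refine ⟨κ, fun q θ hθ h0 hq => ?_⟩
  by_contra! hlt
  set f : ℝ → ℝ := fun s => (Real.cos s ^ 2 + κ * Real.sin s ^ 2)⁻¹ with hf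
  have hpos : ∀ s, 0 < Real.cos s ^ 2 + κ * Real.sin s ^ 2 := fun s =>
    one_pos.trans_le (one_le_cos_sq_add hκ1 s)
  have hfc : Continuous f := Continuous.inv₀ (by fun_prop) fun s => (hpos s).ne'
  have hfpos : ∀ s, 0 < f s := fun s => inv_pos.2 (hpos s)
  set G : ℝ → ℝ := fun y => ∫ s in (0 : ℝ)..y, f s with hG
  have hGd : ∀ y, HasDerivAt G (f y) y := fun y => (hfc.integral_hasStrictDerivAt 0 y).hasDerivAt
  have hGm : StrictMono G := strictMono_of_deriv_pos fun y => by
    rw [(hGd y).deriv]; exact hfpos y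
  -- `G` converts angle into elapsed time, so `G (θ x) - x` is nondecreasing; then `G (θ 1) ≥ 1`,
  -- against `G L < 1`.
  have hcomp := le_of_deriv_nonneg (a := 0) (b := 1)
    (fun x => ((hGd (θ x)).comp x (hθ x)).sub (hasDerivAt_id x)) (fun x hx => by
      have h1 : Real.cos (θ x) ^ 2 + κ * Real.sin (θ x) ^ 2 ≤ pruferField q x (θ x) := by
        have := mul_le_mul_of_nonneg_right (hq x hx) (sq_nonneg (Real.sin (θ x)))
        rw [pruferField]; linarith
      have := mul_le_mul_of_nonneg_left h1 (hfpos (θ x)).le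
      rw [hf] at this
      simp only at this
      rw [inv_mul_cancel₀ (hpos _).ne'] at this
      linarith) zero_le_one
  simp only [Pi.sub_apply, Function.comp_apply, id] at hcomp
  have e1 : G 0 ≤ G (θ 0) := hGm.monotone h0
  have e2 : G (θ 1) < G L := hGm hlt
  have e3 : G 0 = 0 := by simp [hG]
  have e4 : G L < 1 := hκ
  linarith

/-- Rotation on `[0, 1]` alone already brings the angle to `(n + 1) π`, below which it cannot fall
again; the two terms subtracted in `mismatch` total less than `π`. Since `[0, 1] ⊆ [-R, R]`, the
threshold does not depend on `R`. -/
theorem exists_lt_mismatch {V : ℝ → ℝ} (hV : Continuous V) (n : ℕ) :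
    ∃ M₀ : ℝ, ∀ M R, M₀ ≤ M → IsConfining (fun x => V x - M) R →
      n * Real.pi < mismatch (fun x => V x - M) R := by
  obtain ⟨κ, hκ⟩ := exists_prufer_ge ((n + 1 : ℕ) * Real.pi)
  obtain ⟨B, -, hB⟩ := exists_abs_le hV 0 1
  refine ⟨B + κ, fun M R hM h => ?_⟩
  have hR := h.one_le
  have e1 := hκ _ _ h.leftAngle_spec.2 (h.leftAngle_nonneg (by linarith)) fun x hx => by
    have := (abs_le.1 (hB x hx)).2; linarith
  have e2 := h.leftAngle_spec.2.int_mul_pi_le h.continuous (n + 1) hR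
    (by push_cast at e1 ⊢; exact e1)
  have := Real.arctan_lt_pi_div_two (weylSlope (fun x => V x - M) R)
  rw [mismatch]
  push_cast at e2
  linarith

end Growth

/-! ### Exponential decay and stability of the matched solution. -/

section BoundState

variable {q : ℝ → ℝ} {R : ℝ}

/-- If the mismatch vanishes modulo `π`, the solution decaying at `-∞` also decays at `+∞`. -/
theorem IsConfining.leftSol_eq_mul (h : IsConfining q R)
    (hm : (leftSol q R).2 R = -weylSlope q R * (leftSol q R).1 R) :
    (leftSol q R).1 = (fun x => (leftSol q R).1 R * (weyl q R).1 x) ∧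
      (leftSol q R).2 = fun x => (leftSol q R).1 R * (weyl q R).2 x := by
  refine h.isSol.unique h.continuous (h.isWeyl.isSol.const_mul _) (x₀ := R) ?_ ?_
  · rw [h.isWeyl.normalized, mul_one]
  · rw [hm, weylSlope]; ring

/-- Outside `[-R, R]` the solution is a multiple of a decaying one; inside, Gronwall applies. The
constant involves only `R`, `leftSlope` and a bound for `q` on `[-R, R]`, so it can be made uniform
in `k` for dominated convergence. -/
theorem IsConfining.abs_leftSol_le (h : IsConfining q R)
    (hm : (leftSol q R).2 R = -weylSlope q R * (leftSol q R).1 R) {Q : ℝ} (hQ0 : 0 ≤ Q)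
    (hQ : ∀ x ∈ Icc (-R) R, |q x| ≤ Q) (x : ℝ) :
    |(leftSol q R).1 x| ≤
      leftSlope q R * Real.exp ((1 + Q) * (2 * R)) * Real.exp R * Real.exp (-|x|) := by
  have hR := h.one_le
  have hs := h.one_le_leftSlope
  have hE : 1 ≤ Real.exp ((1 + Q) * (2 * R)) := Real.one_le_exp (by positivity)
  have hmid : ∀ y ∈ Icc (-R) R,
      |(leftSol q R).1 y| ≤ leftSlope q R * Real.exp ((1 + Q) * (2 * R)) := fun y hy =>
    (h.isSol.abs_le hQ0 hQ (δ := leftSlope q R) (by simp [h.leftSol_spec.2.1, hs])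
      (by rw [h.leftSol_spec.2.2, abs_of_nonneg (by linarith)]) hy).1.trans (by
        gcongr; linarith [hy.2])
  rw [mul_assoc, ← Real.exp_add, ← sub_eq_add_neg]
  rcases le_total R |x| with hx | hx
  · rcases le_abs'.1 hx with hx | hx
    · rw [h.leftSol_eq_weyl.1]
      simp only
      have e1 := h.reflect.isWeyl.le_exp h.reflect.right (x := -x) (by linarith)
      have e2 := h.reflect.isWeyl.pos (-x) (by linarith)
      rw [abs_of_pos e2, abs_of_nonpos (by linarith)]
      have := one_le_mul_of_one_le_of_one_le hs hE
      exact e1.trans (le_mul_of_one_le_left (Real.exp_pos _).le this)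
    · rw [h.leftSol_eq_mul hm |>.1]
      simp only
      rw [abs_mul, abs_of_pos (h.isWeyl.pos x hx), abs_of_nonneg (a := x) (by linarith)]
      exact mul_le_mul (hmid R ⟨by linarith, le_rfl⟩) (h.isWeyl.le_exp h.right hx)
        (h.isWeyl.pos x hx).le (by positivity)
  · refine (hmid x (abs_le.1 hx)).trans (le_mul_of_one_le_right (by positivity) ?_)
    exact Real.one_le_exp (by linarith)

theorem IsConfining.tendsto_deriv_atBot (h : IsConfining q R) :
    Tendsto (leftSol q R).2 atBot (𝓝 0) := by
  rw [h.leftSol_eq_weyl.2]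
  simpa using ((h.reflect.isWeyl.tendsto_right h.reflect.right).comp tendsto_neg_atBot_atTop).neg

theorem IsConfining.tendsto_deriv_atTop (h : IsConfining q R)
    (hm : (leftSol q R).2 R = -weylSlope q R * (leftSol q R).1 R) :
    Tendsto (leftSol q R).2 atTop (𝓝 0) := by
  rw [(h.leftSol_eq_mul hm).2]
  simpa using (h.isWeyl.tendsto_right h.right).const_mul ((leftSol q R).1 R)

theorem IsSol.exists_abs_sub_le {q₁ u₁ v₁ : ℝ → ℝ} (hq₁ : Continuous q₁) (h₁ : IsSol q₁ u₁ v₁)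
    {a x : ℝ} (hx : a ≤ x) (A : ℝ) : ∃ C, ∀ (q₂ u₂ v₂ : ℝ → ℝ) (δ : ℝ),
      IsSol q₂ u₂ v₂ → 0 ≤ δ → δ ≤ 1 →
      (∀ x, |q₁ x - q₂ x| ≤ δ * (1 + |x|)) → |u₁ a - u₂ a| ≤ δ * A → |v₁ a - v₂ a| ≤ δ * A →
      |u₁ x - u₂ x| ≤ C * δ := by
  obtain ⟨Q, hQ0, hQ⟩ := exists_abs_le hq₁ a x
  obtain ⟨U, hU0, hU⟩ := exists_abs_le h₁.continuous_left a x
  obtain ⟨W, hW0, hW⟩ := exists_abs_le (q := fun x => 1 + |x|) (by fun_prop) a x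
  have hW' : ∀ y ∈ Icc a x, 1 + |y| ≤ W := fun y hy => (le_abs_self _).trans (hW y hy)
  refine ⟨gronwallBound A (1 + (Q + W)) (W * U) (x - a),
    fun q₂ u₂ v₂ δ h₂ hδ hδ1 hq hu hv => ?_⟩
  -- The difference `d = u₁ - u₂` satisfies `d'' = q₂ d + (q₁ - q₂) u₁`, where only the fixed `u₁`
  -- enters the source term.
  have := (abs_le_gronwallBound (q := q₂) (g := fun y => (q₁ y - q₂ y) * u₁ y) (Q := Q + W)
    (G := δ * (W * U)) (δ := δ * A) (a := a) (b := x)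
    (fun y => (h₁.left y).sub (h₂.left y))
    (fun y => ((h₁.right y).sub (h₂.right y)).congr_deriv (by simp only [Pi.sub_apply]; ring))
    (by positivity) (fun y hy => ?_) (fun y hy => ?_) hu hv ⟨hx, le_rfl⟩).1
  · rw [gronwallBound_smul (by positivity)] at this
    simpa [mul_comm] using this
  · have e1 : q₂ y = q₁ y - (q₁ y - q₂ y) := by ring
    rw [e1]
    refine (abs_sub _ _).trans (add_le_add (hQ y hy) ((hq y).trans ?_))
    calc δ * (1 + |y|) ≤ 1 * W := by gcongr; exact hW' y hy
      _ = W := one_mul _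
  · rw [abs_mul, ← mul_assoc]
    refine mul_le_mul ((hq y).trans ?_) (hU y hy) (abs_nonneg _) (by positivity)
    gcongr
    exact hW' y hy

theorem IsConfining.exists_abs_leftSol_sub_le {q₁ : ℝ → ℝ} (h₁ : IsConfining q₁ R) (x : ℝ) :
    ∃ C, ∀ (q₂ : ℝ → ℝ) (δ : ℝ), IsConfining q₂ R → 0 ≤ δ → δ ≤ 1 →
      (∀ x, |q₁ x - q₂ x| ≤ δ * (1 + |x|)) →
      |(leftSol q₁ R).1 x - (leftSol q₂ R).1 x| ≤ C * δ := by
  have hR : 0 ≤ 1 + R := by linarith [h₁.one_le]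
  rcases le_total (-R) x with hx | hx
  · obtain ⟨C, hC⟩ := h₁.isSol.exists_abs_sub_le h₁.continuous hx (1 + R)
    refine ⟨C, fun q₂ δ h₂ hδ hδ1 hq => hC q₂ _ _ δ h₂.isSol hδ hδ1 hq ?_ ?_⟩
    · rw [h₁.leftSol_spec.2.1, h₂.leftSol_spec.2.1, sub_self, abs_zero]; positivity
    · rw [h₁.leftSol_spec.2.2, h₂.leftSol_spec.2.2]
      exact (abs_slope_sub_le h₁ h₂ hδ hq).2
  · obtain ⟨C, hC⟩ := h₁.isSol.reflect.exists_abs_sub_le h₁.reflect.continuous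
      (show R ≤ -x by linarith) (1 + R)
    refine ⟨C, fun q₂ δ h₂ hδ hδ1 hq => ?_⟩
    have := hC _ _ _ δ h₂.isSol.reflect hδ hδ1 (fun y => by simpa using hq (-y)) ?_ ?_
    · simpa using this
    · rw [h₁.leftSol_spec.2.1, h₂.leftSol_spec.2.1, sub_self, abs_zero]; positivity
    · rw [h₁.leftSol_spec.2.2, h₂.leftSol_spec.2.2, neg_sub_neg, abs_sub_comm]
      exact (abs_slope_sub_le h₁ h₂ hδ hq).2

end BoundState

/-! ### Eigenvalues of the operator and the mismatch condition. -/

theorem integrable_exp_neg_abs : Integrable fun x : ℝ => Real.exp (-|x|) := by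
  rw [← integrableOn_univ, ← Iic_union_Ioi (a := (0 : ℝ))]
  refine IntegrableOn.union ?_ ?_
  · refine (integrableOn_exp_Iic 0).congr_fun (fun x hx => ?_) measurableSet_Iic
    simp only [abs_of_nonpos (mem_Iic.1 hx), neg_neg]
  · refine (integrableOn_exp_neg_Ioi 0).congr_fun (fun x hx => ?_) measurableSet_Ioi
    simp only [abs_of_pos (mem_Ioi.1 hx)]

theorem integrable_of_le_exp {f : ℝ → ℝ} (hf : Continuous f) {A : ℝ}
    (h : ∀ x, |f x| ≤ A * Real.exp (-|x|)) : Integrable f :=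
  (integrable_exp_neg_abs.const_mul A).mono' hf.aestronglyMeasurable (Eventually.of_forall h)

theorem tendsto_exp_neg_abs_atTop : Tendsto (fun x : ℝ => Real.exp (-|x|)) atTop (𝓝 0) :=
  Real.tendsto_exp_atBot.comp (tendsto_neg_atTop_atBot.comp tendsto_abs_atTop_atTop)

theorem tendsto_exp_neg_abs_atBot : Tendsto (fun x : ℝ => Real.exp (-|x|)) atBot (𝓝 0) :=
  Real.tendsto_exp_atBot.comp (tendsto_neg_atTop_atBot.comp tendsto_abs_atBot_atTop)

theorem tendsto_zero_of_le_exp {f : ℝ → ℝ} {A : ℝ} (h : ∀ x, |f x| ≤ A * Real.exp (-|x|)) :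
    Tendsto f atTop (𝓝 0) ∧ Tendsto f atBot (𝓝 0) :=
  ⟨squeeze_zero_norm h (by simpa using tendsto_exp_neg_abs_atTop.const_mul A),
    squeeze_zero_norm h (by simpa using tendsto_exp_neg_abs_atBot.const_mul A)⟩

theorem IsSol.mem_eigenvalues {V u v : ℝ → ℝ} {E A : ℝ} (hV : Continuous V)
    (h : IsSol (fun x => V x - E) u v) (hA : ∀ x, |u x| ≤ A * Real.exp (-|x|)) (h0 : u ≠ 0) :
    E ∈ eigenvalues (schrodinger V) := by
  have hA0 : 0 ≤ A := by
    have := (abs_nonneg _).trans (hA 0)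
    simpa using this
  have hc : Continuous fun x => (u x : ℂ) := Complex.continuous_ofReal.comp h.continuous_left
  have hmem : MemLp (fun x => (u x : ℂ)) 2 volume := by
    rw [memLp_two_iff_integrable_sq_norm hc.aestronglyMeasurable]
    simp only [Complex.norm_real, Real.norm_eq_abs, sq_abs]
    refine integrable_of_le_exp (A := A * A) (h.continuous_left.pow 2) fun x => ?_
    rw [abs_pow, sq, mul_assoc]
    have e1 : Real.exp (-|x|) ≤ 1 := Real.exp_le_one_iff.2 (by simp)
    calc |u x| * |u x| ≤ (A * Real.exp (-|x|)) * (A * 1) :=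
          mul_le_mul (hA x) ((hA x).trans (by gcongr)) (abs_nonneg _) (by positivity)
      _ = _ := by ring
  have hgraph : (hmem.toLp, (E : ℂ) • hmem.toLp) ∈ (schrodinger V).graph := by
    rw [schrodinger_graph]
    refine ⟨fun x => (u x : ℂ), fun x => (v x : ℂ), fun x => (((V x - E) * u x : ℝ) : ℂ),
      ⟨fun x => (h.left x).ofReal_comp, ?_, fun x y => ?_⟩, hmem.coeFn_toLp, ?_⟩
    · refine (Complex.continuous_ofReal.comp ?_).locallyIntegrable
      exact (hV.sub continuous_const).mul h.continuous_left
    · refine intervalIntegral.integral_eq_sub_of_hasDerivAt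
        (fun t _ => (h.right t).ofReal_comp) ?_
      refine (Complex.continuous_ofReal.comp ?_).intervalIntegrable _ _
      exact (hV.sub continuous_const).mul h.continuous_left
    · filter_upwards [Lp.coeFn_smul (E : ℂ) hmem.toLp, hmem.coeFn_toLp] with x h1 h2
      simp only [h1, Pi.smul_apply, h2, smul_eq_mul]
      push_cast
      ring
  rw [LinearPMap.mem_graph_iff] at hgraph
  obtain ⟨ψ, h1, h2⟩ := hgraph
  simp only at h1 h2
  refine ⟨ψ, fun hψ => h0 ?_, by rw [h2, h1]⟩
  rw [h1, Lp.eq_zero_iff_ae_eq_zero] at hψ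
  have : (fun x => (u x : ℂ)) = 0 := (hc.ae_eq_iff_eq volume (continuous_const (y := (0 : ℂ)))).1
    (hmem.coeFn_toLp.symm.trans hψ)
  funext x
  simpa using congrFun this x

/-- The weak second derivative agrees almost everywhere with the continuous function `(V - E) f`, so
`f` is a classical solution. As the equation is real, the real or the imaginary part of `f` is a
nonzero real solution. -/
theorem exists_isSol_of_mem_eigenvalues {V : ℝ → ℝ} {E : ℝ} (hV : Continuous V)
    (h : E ∈ eigenvalues (schrodinger V)) :
    ∃ g g', IsSol (fun x => V x - E) g g' ∧ g ≠ 0 ∧ Integrable fun x => g x ^ 2 := by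
  obtain ⟨ψ, hψ, hE⟩ := h
  have hgraph := (schrodinger V).mem_graph ψ
  rw [schrodinger_graph, hE] at hgraph
  obtain ⟨f, f₁, f₂, hf, hu, hw⟩ := hgraph
  simp only at hu hw
  have hfc : Continuous f := continuous_iff_continuousAt.2 fun x => (hf.hasDerivAt x).continuousAt
  have hf2 : f₂ =ᵐ[volume] fun x => ((V x - E : ℝ) : ℂ) * f x := by
    filter_upwards [hu, hw, Lp.coeFn_smul (E : ℂ) (ψ : L2)] with x h1 h2 h3
    rw [h3, Pi.smul_apply, h1, smul_eq_mul] at h2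
    push_cast
    linear_combination h2
  have hqc : Continuous fun x => ((V x - E : ℝ) : ℂ) * f x :=
    (Complex.continuous_ofReal.comp (hV.sub continuous_const)).mul hfc
  have hf1 : ∀ x, HasDerivAt f₁ (((V x - E : ℝ) : ℂ) * f x) x := by
    intro x
    have e : f₁ = fun y => (∫ t in (0 : ℝ)..y, ((V t - E : ℝ) : ℂ) * f t) + f₁ 0 := by
      funext y
      rw [← intervalIntegral.integral_congr_ae (hf2.mono fun t ht _ => ht), hf.integral_eq]
      ring
    rw [e]
    exact (hqc.integral_hasStrictDerivAt 0 x).hasDerivAt.add_const _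
  have hint : Integrable fun x => ‖f x‖ ^ 2 :=
    (memLp_two_iff_integrable_sq_norm hfc.aestronglyMeasurable).1
      ((memLp_congr_ae hu).1 (Lp.memLp (ψ : L2)))
  have hf0 : ∃ x, f x ≠ 0 := by
    by_contra! h0
    refine hψ (Lp.eq_zero_iff_ae_eq_zero.2 (hu.trans (Eventually.of_forall h0)))
  have key : ∀ L : ℂ →L[ℝ] ℝ, (∀ z, |L z| ≤ ‖z‖) → (∃ x, L (f x) ≠ 0) →
      ∃ g g', IsSol (fun x => V x - E) g g' ∧ g ≠ 0 ∧ Integrable fun x => g x ^ 2 := by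
    rintro L hL ⟨x, hx⟩
    have hLc : Continuous fun x => L (f x) := L.continuous.comp hfc
    refine ⟨fun x => L (f x), fun x => L (f₁ x),
      ⟨fun x => L.hasFDerivAt.comp_hasDerivAt x (hf.hasDerivAt x), fun x => ?_⟩,
      fun h0 => hx (congrFun h0 x), ?_⟩
    · refine (L.hasFDerivAt.comp_hasDerivAt x (hf1 x)).congr_deriv ?_
      rw [← Complex.real_smul, map_smul, smul_eq_mul]
    · refine hint.mono' (hLc.pow 2).aestronglyMeasurable (Eventually.of_forall fun x => ?_)
      rw [Real.norm_eq_abs, abs_pow]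
      exact pow_le_pow_left₀ (abs_nonneg _) (hL _) 2
  obtain ⟨x, hx⟩ := hf0
  by_cases hre : (f x).re = 0
  · exact key Complex.imCLM Complex.abs_im_le_norm
      ⟨x, fun him => hx (Complex.ext hre him)⟩
  · exact key Complex.reCLM Complex.abs_re_le_norm ⟨x, hre⟩

section

variable {q : ℝ → ℝ} {R : ℝ}

theorem IsConfining.leftSol_ne_zero (h : IsConfining q R) : (leftSol q R).1 ≠ 0 := fun h0 => by
  have := h.leftSol_spec.2.1
  rw [h0] at this
  simp at this

/-- Square integrability at `-∞` fixes the logarithmic derivative at `-R`, leaving one free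
constant. This is the simplicity of the eigenvalues. -/
theorem IsConfining.eq_const_mul_leftSol (h : IsConfining q R) {g g' : ℝ → ℝ} (hg : IsSol q g g')
    (hint : Integrable fun x => g x ^ 2) :
    g = (fun x => g (-R) * (leftSol q R).1 x) ∧ g' = fun x => g (-R) * (leftSol q R).2 x := by
  have hint' : Integrable fun x => g (-x) ^ 2 := hint.comp_neg
  have e := h.reflect.isWeyl.wronskian_eq_zero h.reflect.right hg.reflect hint'.integrableOn
  refine hg.unique h.continuous (h.isSol.const_mul (g (-R))) (x₀ := -R) ?_ ?_
  · rw [h.leftSol_spec.2.1, mul_one]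
  · rw [h.leftSol_spec.2.2, leftSlope, weylSlope]; linarith

theorem mem_eigenvalues_iff {V : ℝ → ℝ} {E : ℝ} (hV : Continuous V)
    (h : IsConfining (fun x => V x - E) R) :
    E ∈ eigenvalues (schrodinger V) ↔
      ∃ n : ℤ, mismatch (fun x => V x - E) R = n * Real.pi := by
  rw [h.mismatch_eq_iff]
  constructor
  · intro hE
    obtain ⟨g, g', hg, hg0, hint⟩ := exists_isSol_of_mem_eigenvalues hV hE
    obtain ⟨e1, e2⟩ := h.eq_const_mul_leftSol hg hint
    have e3 := h.isWeyl.wronskian_eq_zero h.right hg hint.integrableOn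
    have hne : g (-R) ≠ 0 := fun h0 => hg0 (by rw [e1, h0]; funext x; simp)
    have e1 := congrFun e1 R
    have e2 := congrFun e2 R
    rw [e1, e2] at e3
    refine mul_left_cancel₀ hne (e3.trans ?_)
    rw [weylSlope]; ring
  · intro hm
    obtain ⟨Q, hQ0, hQ⟩ := exists_abs_le h.continuous (-R) R
    exact h.isSol.mem_eigenvalues hV (h.abs_leftSol_le hm hQ0 hQ) h.leftSol_ne_zero

end

/-! ### Counting eigenvalues. -/

/-- The number of elements of `S` below `x` increases strictly along `S`, so the set whose infimum
is taken is the singleton `{E}`. -/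
theorem nthSmallest_eq_of_encard {S : Set ℝ} {E : ℝ} {j : ℕ} (hE : E ∈ S)
    (hj : {y | y ∈ S ∧ y < E}.encard + 1 = (j : ℕ∞)) : nthSmallest S j = E := by
  have hlt : ∀ x y : ℝ, x ∈ S → x < y → {z | z ∈ S ∧ z < x}.encard + 1 = (j : ℕ∞) →
      {z | z ∈ S ∧ z < y}.encard + 1 ≠ (j : ℕ∞) := by
    intro x y hx hxy h1 h2
    have hsub : insert x {z | z ∈ S ∧ z < x} ⊆ {z | z ∈ S ∧ z < y} := by
      rintro z (rfl | ⟨h, h'⟩)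
      · exact ⟨hx, hxy⟩
      · exact ⟨h, h'.trans hxy⟩
    have := encard_le_encard hsub
    rw [encard_insert_of_notMem (by simp), h1] at this
    have h3 : (j : ℕ∞) + 1 ≤ j := (add_le_add_left this 1).trans h2.le
    have h4 : j + 1 ≤ j := by exact_mod_cast h3
    omega
  have : {x | x ∈ S ∧ {y | y ∈ S ∧ y < x}.encard + 1 = (j : ℕ∞)} = {E} := by
    ext x
    refine ⟨fun ⟨hx, hxj⟩ => ?_, fun hx => by rw [mem_singleton_iff.1 hx]; exact ⟨hE, hj⟩⟩
    rcases lt_trichotomy x E with h | h | h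
    · exact absurd hj (hlt x E hx h hxj)
    · exact h
    · exact absurd hxj (hlt E x hE h hj)
  rw [nthSmallest, this, csInf_singleton]

/-- Counting by an increasing function `Θ` that takes values in `π ℤ` exactly on `S`. -/
theorem nthSmallest_eq_of_strictMonoOn {S : Set ℝ} {Θ : ℝ → ℝ} {M E a : ℝ} {j : ℕ} (hj : 1 ≤ j)
    (hcont : ContinuousOn Θ (Iic M)) (hmono : StrictMonoOn Θ (Iic M))
    (hS : ∀ y, y ≤ M → (y ∈ S ↔ ∃ n : ℤ, Θ y = n * Real.pi)) (hlow : ∀ y, y ≤ M → -Real.pi < Θ y)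
    (haM : a ≤ M) (ha : Θ a < 0) (hEM : E ≤ M) (hE : Θ E = (j - 1) * Real.pi) :
    nthSmallest S j = E := by
  obtain ⟨m, rfl⟩ : ∃ m, j = m + 1 := ⟨j - 1, by omega⟩
  push_cast at hE
  rw [add_sub_cancel_right] at hE
  have hpi := Real.pi_pos
  have haE : a < E := by
    rw [← hmono.lt_iff_lt (mem_Iic.2 haM) (mem_Iic.2 hEM), hE]
    exact ha.trans_le (by positivity)
  -- The condition `n < m` is put inside the existential so that the chosen function is total; its
  -- values for `n ≥ m` are irrelevant.
  have hroot : ∀ n : ℕ, ∃ y, n < m → y < E ∧ Θ y = n * Real.pi := by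
    intro n
    by_cases hn : n < m
    · have hn' : (n : ℝ) < m := by exact_mod_cast hn
      obtain ⟨y, hy, hy'⟩ := intermediate_value_Ico haE.le
        (hcont.mono fun y hy => mem_Iic.2 (hy.2.trans hEM))
        (show (n * Real.pi : ℝ) ∈ Ico (Θ a) (Θ E) from
          ⟨ha.le.trans (by positivity), by rw [hE]; gcongr⟩)
      exact ⟨y, fun _ => ⟨hy.2, hy'⟩⟩
    · exact ⟨0, fun h => absurd h hn⟩
  choose e he using hroot
  have hset : {y | y ∈ S ∧ y < E} = e '' Iio m := by
    ext y
    constructor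
    · rintro ⟨hy, hyE⟩
      have hyM := hyE.le.trans hEM
      obtain ⟨n, hn⟩ := (hS y hyM).1 hy
      have h1 := hlow y hyM
      have h2 := hmono (mem_Iic.2 hyM) (mem_Iic.2 hEM) hyE
      rw [hn] at h1 h2
      rw [hE] at h2
      have h1' : (-1 : ℝ) < n := by
        by_contra! hc
        have := mul_le_mul_of_nonneg_right hc hpi.le
        linarith
      have h2' : (n : ℝ) < m := lt_of_mul_lt_mul_right h2 hpi.le
      have h3 : -1 < n := by exact_mod_cast h1'
      have h4 : n < m := by exact_mod_cast h2'
      lift n to ℕ using by omega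
      have h5 : n < m := by exact_mod_cast h4
      refine ⟨n, h5, hmono.injOn (mem_Iic.2 ((he n h5).1.le.trans hEM)) (mem_Iic.2 hyM) ?_⟩
      rw [(he n h5).2, hn]
      simp
    · rintro ⟨n, hn, rfl⟩
      have := he n hn
      exact ⟨(hS _ (this.1.le.trans hEM)).2 ⟨n, by simpa using this.2⟩, this.1⟩
  have hinj : InjOn e (Iio m) := by
    intro n hn n' hn' h
    have h1 := (he n hn).2
    rw [h, (he n' hn').2] at h1
    exact_mod_cast (mul_right_cancel₀ hpi.ne' h1).symm
  refine nthSmallest_eq_of_encard ((hS E hEM).2 ⟨m, by simpa using hE⟩) ?_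
  rw [hset, hinj.encard_image, ← Finset.coe_Iio, encard_coe_eq_coe_finsetCard]
  simp

/-! ### The fiber potentials and continuity of the band functions. -/

/-- The potential of the fiber operator, shifted by the energy. -/
def fiberPot (b : ℝ → ℝ) (k E x : ℝ) : ℝ := (k - beta b x) ^ 2 - E

/-- A continuous magnetic field with values in `[bm, bp]`. -/
structure IsBoundedField (bm bp : ℝ) (b : ℝ → ℝ) : Prop where
  continuous : Continuous b
  mem_Icc : ∀ x, b x ∈ Icc bm bp

theorem IsSmoothedField.isBoundedField {bm bp ε : ℝ} {b : ℝ → ℝ} (h : IsSmoothedField bm bp ε b)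
    (hbp : bm ≤ bp) (hb : Continuous b) : IsBoundedField bm bp b := by
  refine ⟨hb, fun x => ?_⟩
  by_cases h1 : ε < x
  · rw [h.eq_right x h1]; exact ⟨hbp, le_rfl⟩
  by_cases h2 : x < -ε
  · rw [h.eq_left x h2]; exact ⟨le_rfl, hbp⟩
  exact h.mem_Icc x (abs_le.2 ⟨not_lt.1 h2, not_lt.1 h1⟩)

namespace IsBoundedField

variable {bm bp : ℝ} {b : ℝ → ℝ}

theorem hasDerivAt_beta (h : IsBoundedField bm bp b) (x : ℝ) : HasDerivAt (beta b) (b x) x :=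
  (h.continuous.integral_hasStrictDerivAt 0 x).hasDerivAt

theorem continuous_beta (h : IsBoundedField bm bp b) : Continuous (beta b) :=
  continuous_iff_continuousAt.2 fun x => (h.hasDerivAt_beta x).continuousAt

theorem continuous_fiberPot (h : IsBoundedField bm bp b) (k E : ℝ) :
    Continuous (fiberPot b k E) := by
  have := h.continuous_beta
  unfold fiberPot
  fun_prop

theorem beta_sub (h : IsBoundedField bm bp b) {x y : ℝ} (hxy : x ≤ y) :
    bm * (y - x) ≤ beta b y - beta b x ∧ beta b y - beta b x ≤ bp * (y - x) := by
  have e1 := le_of_deriv_nonneg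
    (fun x => (h.hasDerivAt_beta x).sub ((hasDerivAt_id x).const_mul bm))
    (fun z _ => by linarith [(h.mem_Icc z).1]) hxy
  have e2 := le_of_deriv_nonpos
    (fun x => (h.hasDerivAt_beta x).sub ((hasDerivAt_id x).const_mul bp))
    (fun z _ => by linarith [(h.mem_Icc z).2]) hxy
  simp only [Pi.sub_apply, id] at e1 e2
  constructor <;> linarith

theorem abs_beta (h : IsBoundedField bm bp b) (hbm : 0 ≤ bm) (x : ℝ) :
    bm * |x| ≤ |beta b x| ∧ |beta b x| ≤ bp * |x| := by
  have h0 : beta b 0 = 0 := by simp [beta]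
  rcases le_total 0 x with hx | hx
  · have := h.beta_sub hx
    rw [h0, sub_zero, sub_zero] at this
    have h1 : 0 ≤ beta b x := (mul_nonneg hbm hx).trans this.1
    rwa [abs_of_nonneg hx, abs_of_nonneg h1]
  · have := h.beta_sub hx
    rw [h0, zero_sub, zero_sub] at this
    have h1 : beta b x ≤ 0 := by
      have := (mul_nonneg hbm (neg_nonneg.2 hx)).trans this.1
      linarith
    rwa [abs_of_nonpos hx, abs_of_nonpos h1]

theorem isConfining (h : IsBoundedField bm bp b) (hbm : 0 < bm) {k K E M R : ℝ} (hk : |k| ≤ K)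
    (hE : E ≤ M) (hM : 0 ≤ M) (hR : 1 ≤ R) (hRK : K + M + 1 ≤ bm * R) :
    IsConfining (fiberPot b k E) R := by
  refine ⟨h.continuous_fiberPot k E, hR, fun x hx => ?_⟩
  have e1 := (h.abs_beta hbm.le x).1
  have e2 : bm * R ≤ bm * |x| := by gcongr
  have e3 := abs_sub_abs_le_abs_sub (beta b x) k
  rw [abs_sub_comm] at e3
  -- For `|x| ≥ R` one has `|β| ≥ bm R ≥ K + M + 1`; then `(k - β)² - E ≥ (M + 1)² - M ≥ 1`.
  have e4 : M + 1 ≤ |k - beta b x| := by linarith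
  rw [fiberPot, ← sq_abs]
  nlinarith

theorem abs_two_mul_le (h : IsBoundedField bm bp b) (hbm : 0 ≤ bm) {k k' K : ℝ}
    (hk : |k| ≤ K) (hk' : |k'| ≤ K) (x : ℝ) :
    |k + k' - 2 * beta b x| ≤ (2 * K + 2 * bp) * (1 + |x|) := by
  have e1 := (h.abs_beta hbm x).2
  have hbp : 0 ≤ bp := hbm.trans ((h.mem_Icc 0).1.trans (h.mem_Icc 0).2)
  have hK : 0 ≤ K := (abs_nonneg _).trans hk
  have e2 : |k + k' - 2 * beta b x| ≤ |k| + |k'| + 2 * |beta b x| := by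
    refine (abs_sub _ _).trans ?_
    rw [abs_mul, abs_two]
    gcongr
    exact abs_add_le _ _
  have := abs_nonneg x
  nlinarith

theorem fiberPot_sub (b : ℝ → ℝ) (k k' E E' x : ℝ) :
    fiberPot b k E x - fiberPot b k' E' x = (k - k') * (k + k' - 2 * beta b x) - (E - E') := by
  rw [fiberPot, fiberPot]; ring

theorem abs_fiberPot_sub_le (h : IsBoundedField bm bp b) (hbm : 0 ≤ bm) {k k' K : ℝ}
    (hk : |k| ≤ K) (hk' : |k'| ≤ K) (E E' x : ℝ) :
    |fiberPot b k E x - fiberPot b k' E' x| ≤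
      ((2 * K + 2 * bp) * |k - k'| + |E - E'|) * (1 + |x|) := by
  rw [fiberPot_sub]
  refine (abs_sub _ _).trans ?_
  rw [abs_mul]
  have e1 := mul_le_mul_of_nonneg_left (h.abs_two_mul_le hbm hk hk' x) (abs_nonneg (k - k'))
  have := mul_nonneg (abs_nonneg (E - E')) (abs_nonneg x)
  linarith

/-- Near `k₀` the `j`-th eigenvalue is the root of `mismatch = (j - 1) π`, and it is continuous. -/
theorem exists_band_root (h : IsBoundedField bm bp b) (hbm : 0 < bm) {j : ℕ} (hj : 1 ≤ j)
    (k₀ : ℝ) : ∃ R, (∀ᶠ k in 𝓝 k₀, IsConfining (fiberPot b k (band b j k)) R ∧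
      ∃ n : ℤ, mismatch (fiberPot b k (band b j k)) R = n * Real.pi) ∧
      ContinuousAt (band b j) k₀ := by
  obtain ⟨M₀, hM₀⟩ := exists_lt_mismatch (V := fun x => (k₀ - beta b x) ^ 2)
    (by have := h.continuous_beta; fun_prop) j
  -- `M` is an energy at which the mismatch for `k₀` already exceeds `j π`. One radius `R` then
  -- serves all `|k| ≤ K` and all `E ≤ M`.
  set M := max M₀ 0 with hMdef
  have hM : 0 ≤ M := le_max_right _ _
  set K := |k₀| + 1 with hK
  have hK0 : 0 ≤ K := by positivity
  set R := max 1 ((K + M + 1) / bm) with hRdef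
  have hR : 1 ≤ R := le_max_left _ _
  have hRK : K + M + 1 ≤ bm * R := by
    have : (K + M + 1) / bm ≤ R := le_max_right _ _
    rw [div_le_iff₀ hbm] at this
    linarith
  have hkK : ∀ k, |k - k₀| ≤ 1 → |k| ≤ K := fun k hk => by
    have := abs_sub_abs_le_abs_sub k k₀
    linarith
  have hk₀ : |k₀| ≤ K := by linarith
  have hconf : ∀ k, |k| ≤ K → ∀ E, E ≤ M → IsConfining (fiberPot b k E) R := fun k hk E hE =>
    h.isConfining hbm hk hE hM hR hRK
  set Θ : ℝ → ℝ → ℝ := fun k E => mismatch (fiberPot b k E) R with hΘ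
  have hmono : ∀ k, |k| ≤ K → StrictMonoOn (Θ k) (Iic M) := fun k hk E hE E' hE' hlt =>
    mismatch_lt_mismatch (hconf k hk E hE) (hconf k hk E' hE') fun x => by
      simp only [fiberPot]; linarith
  have hcont : ∀ k, |k| ≤ K → ContinuousOn (Θ k) (Iic M) := by
    intro k hk E hE
    obtain ⟨C, -, hC⟩ := (hconf k hk E hE).exists_abs_mismatch_sub_le
    refine tendsto_iff_norm_sub_tendsto_zero.2 (squeeze_zero' (Eventually.of_forall fun _ =>
      norm_nonneg _) (g := fun E' => C * |E - E'|) ?_ ?_)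
    · filter_upwards [self_mem_nhdsWithin] with E' hE'
      rw [norm_sub_rev]
      refine hC _ _ (hconf k hk E' hE') (abs_nonneg _) fun x => ?_
      have := h.abs_fiberPot_sub_le hbm.le hk hk E E' x
      simpa using this
    · have : Continuous fun E' => C * |E - E'| := by fun_prop
      simpa using (this.tendsto E).mono_left nhdsWithin_le_nhds
  have hcontk : ∀ E, E ≤ M → ContinuousAt (fun k => Θ k E) k₀ := by
    intro E hE
    obtain ⟨C, -, hC⟩ := (hconf k₀ hk₀ E hE).exists_abs_mismatch_sub_le
    have hbp : 0 ≤ bp := hbm.le.trans ((h.mem_Icc 0).1.trans (h.mem_Icc 0).2)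
    refine tendsto_iff_norm_sub_tendsto_zero.2 (squeeze_zero' (Eventually.of_forall fun _ =>
      norm_nonneg _) (g := fun k => C * ((2 * K + 2 * bp) * |k₀ - k|)) ?_ ?_)
    · filter_upwards [Metric.closedBall_mem_nhds k₀ one_pos] with k hk
      have hk := hkK k (by simpa [Real.dist_eq] using hk)
      rw [norm_sub_rev]
      refine hC _ _ (hconf k hk E hE) (by positivity) fun x => ?_
      have := h.abs_fiberPot_sub_le hbm.le hk₀ hk E E x
      simpa using this
    · have : Continuous fun k => C * ((2 * K + 2 * bp) * |k₀ - k|) := by fun_prop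
      simpa using this.tendsto k₀
  have hneg : ∀ k, |k| ≤ K → Θ k 0 < 0 := fun k hk =>
    (hconf k hk 0 hM).mismatch_neg fun x => by simp only [fiberPot, sub_zero]; positivity
  have hband : ∀ k, |k| ≤ K → ∀ E, E ≤ M → Θ k E = (j - 1) * Real.pi → band b j k = E := by
    intro k hk E hE hroot
    refine nthSmallest_eq_of_strictMonoOn hj (hcont k hk) (hmono k hk) (fun y hy => ?_)
      (fun y hy => (hconf k hk y hy).neg_pi_lt_mismatch) hM (hneg k hk) hE hroot
    exact mem_eigenvalues_iff (by have := h.continuous_beta; fun_prop) (hconf k hk y hy)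
  have hj1 : (0 : ℝ) ≤ j - 1 := by
    have : (1 : ℝ) ≤ j := by exact_mod_cast hj
    linarith
  have hpi := Real.pi_pos
  have htop : (j - 1) * Real.pi < Θ k₀ M := by
    have := hM₀ M R (le_max_left _ _) (hconf k₀ hk₀ M le_rfl)
    have h2 : Θ k₀ M = mismatch (fun x => (k₀ - beta b x) ^ 2 - M) R := rfl
    rw [h2]
    linarith
  obtain ⟨E₀, hE₀, hroot₀⟩ := intermediate_value_Ioo hM
    ((hcont k₀ hk₀).mono fun y hy => mem_Iic.2 hy.2)
    (show (j - 1) * Real.pi ∈ Ioo (Θ k₀ 0) (Θ k₀ M) from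
      ⟨(hneg k₀ hk₀).trans_le (by positivity), htop⟩)
  have hE₀M : E₀ ≤ M := hE₀.2.le
  -- At `E₀ ± η'` the mismatch for `k₀` lies strictly on either side of `(j - 1) π`. By continuity
  -- in `k` this persists nearby, so the root for `k` is trapped within `η'` of `E₀`.
  have hnear : ∀ η, 0 < η → ∀ᶠ k in 𝓝 k₀, |k| ≤ K ∧ ∃ E, |E - E₀| < η ∧ E ≤ M ∧
      Θ k E = (j - 1) * Real.pi := by
    intro η hη
    set η' := min (η / 2) (M - E₀)
    have hη' : 0 < η' := lt_min (by linarith) (by linarith [hE₀.2])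
    have hη1 : η' < η := (min_le_left _ _).trans_lt (by linarith)
    have hη2 : E₀ + η' ≤ M := by have := min_le_right (η / 2) (M - E₀); linarith
    have l1 : Θ k₀ (E₀ - η') < (j - 1) * Real.pi := by
      rw [← hroot₀]
      exact hmono k₀ hk₀ (mem_Iic.2 (by linarith)) (mem_Iic.2 hE₀M) (by linarith)
    have l2 : (j - 1) * Real.pi < Θ k₀ (E₀ + η') := by
      rw [← hroot₀]
      exact hmono k₀ hk₀ (mem_Iic.2 hE₀M) (mem_Iic.2 hη2) (by linarith)
    filter_upwards [(hcontk (E₀ - η') (by linarith)).eventually_lt continuousAt_const l1,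
      continuousAt_const.eventually_lt (hcontk (E₀ + η') hη2) l2,
      Metric.closedBall_mem_nhds k₀ one_pos] with k h1 h2 h3
    have hk := hkK k (by simpa [Real.dist_eq] using h3)
    obtain ⟨E, hE, hE'⟩ := intermediate_value_Ioo (show E₀ - η' ≤ E₀ + η' by linarith)
      ((hcont k hk).mono fun y hy => mem_Iic.2 (hy.2.trans hη2)) ⟨h1, h2⟩
    exact ⟨hk, E, abs_lt.2 ⟨by linarith [hE.1], by linarith [hE.2]⟩, hE.2.le.trans hη2, hE'⟩
  have hband₀ := hband k₀ hk₀ E₀ hE₀M hroot₀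
  refine ⟨R, ?_, ?_⟩
  · filter_upwards [hnear 1 one_pos] with k hk
    obtain ⟨hk, E, -, hE, hE'⟩ := hk
    rw [hband k hk E hE hE']
    exact ⟨hconf k hk E hE, j - 1, by push_cast; exact hE'⟩
  · rw [Metric.continuousAt_iff']
    intro η hη
    filter_upwards [hnear η hη] with k hk
    obtain ⟨hk, E, h1, hE, hE'⟩ := hk
    rw [hband k hk E hE hE', hband₀, Real.dist_eq]
    exact h1

end IsBoundedField

/-! ### Integral identities for bound states. -/

/-- A solution of `u'' = q u` with exponential decay, whose derivative tends to zero. -/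
structure IsBoundState (q u v : ℝ → ℝ) (C : ℝ) : Prop where
  isSol : IsSol q u v
  le_exp : ∀ x, |u x| ≤ C * Real.exp (-|x|)
  tendsto_atTop : Tendsto v atTop (𝓝 0)
  tendsto_atBot : Tendsto v atBot (𝓝 0)

theorem one_add_abs_mul_exp_le (x : ℝ) : (1 + |x|) * Real.exp (-|x|) ≤ 1 := by
  have h := Real.add_one_le_exp |x|
  calc (1 + |x|) * Real.exp (-|x|) ≤ Real.exp |x| * Real.exp (-|x|) := by gcongr; linarith
    _ = 1 := by rw [← Real.exp_add, add_neg_cancel, Real.exp_zero]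

theorem one_add_abs_sq_mul_exp_le (x : ℝ) :
    (1 + |x|) ^ 2 * Real.exp (-|x|) ≤ 4 := by
  have h := one_add_abs_mul_exp_le (x / 2)
  rw [abs_div, abs_two] at h
  have h0 := abs_nonneg x
  have h1 : (1 + |x|) * Real.exp (-(|x| / 2)) ≤ 2 := by
    have : (1 + |x|) * Real.exp (-(|x| / 2)) ≤ 2 * ((1 + |x| / 2) * Real.exp (-(|x| / 2))) := by
      rw [← mul_assoc]
      gcongr
      linarith
    linarith
  have e : Real.exp (-|x|) = Real.exp (-(|x| / 2)) * Real.exp (-(|x| / 2)) := by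
    rw [← Real.exp_add]; ring_nf
  rw [e, show (1 + |x|) ^ 2 * (Real.exp (-(|x| / 2)) * Real.exp (-(|x| / 2))) =
    ((1 + |x|) * Real.exp (-(|x| / 2))) * ((1 + |x|) * Real.exp (-(|x| / 2))) by ring]
  have h2 : 0 ≤ (1 + |x|) * Real.exp (-(|x| / 2)) := by positivity
  nlinarith

namespace IsBoundState

variable {q u v q' u' v' : ℝ → ℝ} {C C' : ℝ}

theorem abs_mul_le (h : IsBoundState q u v C) (h' : IsBoundState q' u' v' C') (x : ℝ) :
    |u x * u' x| ≤ C * C' * (Real.exp (-|x|) * Real.exp (-|x|)) := by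
  rw [abs_mul]
  calc |u x| * |u' x| ≤ (C * Real.exp (-|x|)) * (C' * Real.exp (-|x|)) :=
        mul_le_mul (h.le_exp x) (h'.le_exp x) (abs_nonneg _) ((abs_nonneg _).trans (h.le_exp x))
    _ = _ := by ring

theorem nonneg (h : IsBoundState q u v C) : 0 ≤ C := by
  simpa using (abs_nonneg _).trans (h.le_exp 0)

theorem abs_mul_mul_le (h : IsBoundState q u v C) (h' : IsBoundState q' u' v' C') {p : ℝ → ℝ}
    {D : ℝ} (hp : ∀ x, |p x| ≤ D * (1 + |x|)) (x : ℝ) :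
    |p x * (u x * u' x)| ≤ D * (C * C') * Real.exp (-|x|) := by
  have hC := h.nonneg
  have hC' := h'.nonneg
  have hD : 0 ≤ D := by simpa using (abs_nonneg _).trans (hp 0)
  rw [abs_mul]
  calc |p x| * |u x * u' x|
      ≤ (D * (1 + |x|)) * (C * C' * (Real.exp (-|x|) * Real.exp (-|x|))) :=
        mul_le_mul (hp x) (h.abs_mul_le h' x) (abs_nonneg _) (by positivity)
    _ = D * (C * C') * Real.exp (-|x|) * ((1 + |x|) * Real.exp (-|x|)) := by ring
    _ ≤ D * (C * C') * Real.exp (-|x|) * 1 := by gcongr; exact one_add_abs_mul_exp_le x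
    _ = _ := mul_one _

theorem integrable_mul_mul (h : IsBoundState q u v C) (h' : IsBoundState q' u' v' C')
    {p : ℝ → ℝ} (hpc : Continuous p) {D : ℝ} (hp : ∀ x, |p x| ≤ D * (1 + |x|)) :
    Integrable fun x => p x * (u x * u' x) :=
  integrable_of_le_exp
    (hpc.mul (h.isSol.continuous_left.mul h'.isSol.continuous_left)) (h.abs_mul_mul_le h' hp)

theorem tendsto_left (h : IsBoundState q u v C) : Tendsto u atTop (𝓝 0) ∧ Tendsto u atBot (𝓝 0) :=
  tendsto_zero_of_le_exp h.le_exp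

/-- The integrand is the derivative of the Wronskian, which vanishes at both ends. -/
theorem integral_eq_zero (h : IsBoundState q u v C) (h' : IsBoundState q' u' v' C')
    (hq : Continuous q) (hq' : Continuous q') {D : ℝ}
    (hD : ∀ x, |q x - q' x| ≤ D * (1 + |x|)) : ∫ x, (q x - q' x) * (u x * u' x) = 0 := by
  rw [integral_of_hasDerivAt_of_tendsto (h.isSol.hasDerivAt_wronskian h'.isSol)
    (h.integrable_mul_mul h' (hq.sub hq') hD) (m := 0) (n := 0), sub_zero]
  · simpa using (h.tendsto_atBot.mul h'.tendsto_left.2).sub (h.tendsto_left.2.mul h'.tendsto_atBot)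
  · simpa using (h.tendsto_atTop.mul h'.tendsto_left.1).sub (h.tendsto_left.1.mul h'.tendsto_atTop)

/-- The virial identity `∫ q' u² = 0`. -/
theorem integral_deriv_mul_sq (h : IsBoundState q u v C) {p : ℝ → ℝ}
    (hqp : ∀ x, HasDerivAt q (p x) x) (hpc : Continuous p) {D : ℝ}
    (hp : ∀ x, |p x| ≤ D * (1 + |x|)) {B : ℝ} (hB : ∀ x, |q x| ≤ B * (1 + |x|) ^ 2) :
    ∫ x, p x * (u x * u x) = 0 := by
  -- The primitive is `q u² - u'²`: the terms `2 q u u'` cancel.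
  have hd : ∀ x, HasDerivAt (fun x => q x * (u x * u x) - v x ^ 2) (p x * (u x * u x)) x :=
    fun x => (((hqp x).mul ((h.isSol.left x).mul (h.isSol.left x))).sub
      (h.isSol.hasDerivAt_sq_right x)).congr_deriv (by simp only [Pi.mul_apply]; ring)
  have hB0 : 0 ≤ B := by simpa using (abs_nonneg _).trans (hB 0)
  have hC := h.nonneg
  have hbound : ∀ x, |q x * (u x * u x)| ≤ B * (C * C) * 4 * Real.exp (-|x|) := by
    intro x
    rw [abs_mul]
    calc |q x| * |u x * u x|
        ≤ (B * (1 + |x|) ^ 2) * (C * C * (Real.exp (-|x|) * Real.exp (-|x|))) :=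
          mul_le_mul (hB x) (h.abs_mul_le h x) (abs_nonneg _) (by positivity)
      _ = B * (C * C) * ((1 + |x|) ^ 2 * Real.exp (-|x|)) * Real.exp (-|x|) := by ring
      _ ≤ _ := by gcongr; exact one_add_abs_sq_mul_exp_le x
  obtain ⟨l1, l2⟩ := tendsto_zero_of_le_exp hbound
  rw [integral_of_hasDerivAt_of_tendsto hd (h.integrable_mul_mul h hpc hp) (m := 0) (n := 0),
    sub_zero]
  · simpa using l2.sub (h.tendsto_atBot.pow 2)
  · simpa using l1.sub (h.tendsto_atTop.pow 2)

end IsBoundState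

theorem IsConfining.isBoundState {q : ℝ → ℝ} {R : ℝ} (h : IsConfining q R)
    (hm : ∃ n : ℤ, mismatch q R = n * Real.pi) {Q S : ℝ} (hQ0 : 0 ≤ Q)
    (hQ : ∀ x ∈ Icc (-R) R, |q x| ≤ Q) (hS : leftSlope q R ≤ S) :
    IsBoundState q (leftSol q R).1 (leftSol q R).2
      (S * Real.exp ((1 + Q) * (2 * R)) * Real.exp R) := by
  rw [h.mismatch_eq_iff] at hm
  refine ⟨h.isSol, fun x => (h.abs_leftSol_le hm hQ0 hQ x).trans ?_, h.tendsto_deriv_atTop hm,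
    h.tendsto_deriv_atBot⟩
  gcongr

/-! ### Derivative of the band functions and its sign. -/

namespace IsBoundedField

variable {bm bp : ℝ} {b : ℝ → ℝ}

/-- The Feynman–Hellmann formula. -/
theorem exists_hasDerivAt_band (h : IsBoundedField bm bp b) (hbm : 0 < bm) {j : ℕ} (hj : 1 ≤ j)
    (k₀ : ℝ) : ∃ R u v C, IsConfining (fiberPot b k₀ (band b j k₀)) R ∧
      IsBoundState (fiberPot b k₀ (band b j k₀)) u v C ∧
      (∀ x, x ≤ -R → u x ≠ 0) ∧ (∀ x, R ≤ x → u x ≠ 0) ∧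
      HasDerivAt (band b j)
        ((∫ x, (k₀ + k₀ - 2 * beta b x) * (u x * u x)) / ∫ x, 1 * (u x * u x)) k₀ := by
  obtain ⟨R, hR, hcont⟩ := h.exists_band_root hbm hj k₀
  set ω := band b j
  set q : ℝ → ℝ → ℝ := fun k => fiberPot b k (ω k) with hq
  set K := |k₀| + 1 with hK
  have hk₀ : |k₀| ≤ K := by linarith
  have hbp : 0 ≤ bp := hbm.le.trans ((h.mem_Icc 0).1.trans (h.mem_Icc 0).2)
  set D := 2 * K + 2 * bp with hD
  have hD0 : 0 ≤ D := by positivity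
  obtain ⟨hc₀, hm₀⟩ := hR.self_of_nhds
  set δ : ℝ → ℝ := fun k => D * |k₀ - k| + |ω k₀ - ω k| with hδ
  have hδ0 : ∀ k, 0 ≤ δ k := fun k => by positivity
  have hδlim : Tendsto δ (𝓝 k₀) (𝓝 0) := by
    have h1 : Tendsto (fun k => D * |k₀ - k|) (𝓝 k₀) (𝓝 0) := by
      have : Continuous fun k => D * |k₀ - k| := by fun_prop
      simpa using this.tendsto k₀
    have h2 : Tendsto (fun k => |ω k₀ - ω k|) (𝓝 k₀) (𝓝 0) := by
      simpa using (hcont.tendsto.const_sub (ω k₀)).abs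
    simpa using h1.add h2
  have hev : ∀ᶠ k in 𝓝 k₀, |k| ≤ K ∧ IsConfining (q k) R ∧
      (∃ n : ℤ, mismatch (q k) R = n * Real.pi) ∧ δ k ≤ 1 := by
    filter_upwards [hR, hδlim.eventually_le_const one_pos,
      Metric.closedBall_mem_nhds k₀ one_pos] with k h1 h2 h3
    rw [Metric.mem_closedBall, Real.dist_eq] at h3
    have := abs_sub_abs_le_abs_sub k k₀
    exact ⟨by linarith, h1.1, h1.2, h2⟩
  have hlip : ∀ k, |k| ≤ K → ∀ x, |q k₀ x - q k x| ≤ δ k * (1 + |x|) := fun k hk x =>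
    h.abs_fiberPot_sub_le hbm.le hk₀ hk _ _ x
  obtain ⟨Q, hQ0, hQ⟩ := exists_abs_le hc₀.continuous (-R) R
  have hR1 := hc₀.one_le
  -- When `δ k ≤ 1`, passing from `k₀` to `k` changes both the potential on `[-R, R]` and the left
  -- slope by at most `1 + R`. Hence a single `C` bounds all nearby eigenfunctions.
  set C := (leftSlope (q k₀) R + (1 + R)) * Real.exp ((1 + (Q + (1 + R))) * (2 * R)) * Real.exp R
  have hbs : ∀ᶠ k in 𝓝 k₀, IsBoundState (q k) (leftSol (q k) R).1 (leftSol (q k) R).2 C := by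
    filter_upwards [hev] with k hk
    obtain ⟨hk, hc, hm, hδ1⟩ := hk
    refine hc.isBoundState hm (by positivity) (fun x hx => ?_) ?_
    · have e : q k x = q k₀ x - (q k₀ x - q k x) := by ring
      rw [e]
      refine (abs_sub _ _).trans (add_le_add (hQ x hx) ((hlip k hk x).trans ?_))
      have := abs_le.2 hx
      calc δ k * (1 + |x|) ≤ 1 * (1 + R) := by gcongr
        _ = 1 + R := one_mul _
    · have := (abs_le.1 (abs_slope_sub_le hc₀ hc (hδ0 k) (hlip k hk)).2).1
      have : δ k * (1 + R) ≤ 1 * (1 + R) := by gcongr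
      linarith
  set u : ℝ → ℝ → ℝ := fun k => (leftSol (q k) R).1 with hu
  have hb₀ := hbs.self_of_nhds
  have hulim : ∀ x, Tendsto (fun k => u k x) (𝓝 k₀) (𝓝 (u k₀ x)) := by
    intro x
    obtain ⟨A, hA⟩ := hc₀.exists_abs_leftSol_sub_le x
    refine tendsto_iff_norm_sub_tendsto_zero.2 (squeeze_zero' (Eventually.of_forall fun _ =>
      norm_nonneg _) (g := fun k => A * δ k) ?_ (by simpa using hδlim.const_mul A))
    filter_upwards [hev] with k hk
    rw [norm_sub_rev]
    exact hA (q k) (δ k) hk.2.1 (hδ0 k) hk.2.2.2 (hlip k hk.1)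
  have hlim : ∀ p : ℝ → ℝ → ℝ, (∀ k, Continuous (p k)) →
      (∀ k, |k| ≤ K → ∀ x, |p k x| ≤ (D + 1) * (1 + |x|)) →
      (∀ x, Tendsto (fun k => p k x) (𝓝 k₀) (𝓝 (p k₀ x))) →
      Tendsto (fun k => ∫ x, p k x * (u k x * u k₀ x)) (𝓝 k₀)
        (𝓝 (∫ x, p k₀ x * (u k₀ x * u k₀ x))) := by
    intro p hpc hp hpl
    refine tendsto_integral_filter_of_dominated_convergence
      (fun x => (D + 1) * (C * C) * Real.exp (-|x|)) ?_ ?_ (integrable_exp_neg_abs.const_mul _)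
      (Eventually.of_forall fun x => (hpl x).mul ((hulim x).mul_const _))
    · filter_upwards [hbs] with k hk
      exact ((hpc k).mul (hk.isSol.continuous_left.mul
        hb₀.isSol.continuous_left)).aestronglyMeasurable
    · filter_upwards [hbs, hev] with k hk hk'
      exact Eventually.of_forall (hk.abs_mul_mul_le hb₀ (hp k hk'.1))
  have hone : ∀ x : ℝ, |(1 : ℝ)| ≤ (D + 1) * (1 + |x|) := fun x => by
    rw [abs_one]
    exact one_le_mul_of_one_le_of_one_le (by linarith) (by linarith [abs_nonneg x])
  have hweight : ∀ k, |k| ≤ K → ∀ x, |k + k₀ - 2 * beta b x| ≤ (D + 1) * (1 + |x|) :=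
    fun k hk x => (h.abs_two_mul_le hbm.le hk hk₀ x).trans
      (mul_le_mul_of_nonneg_right (by linarith) (by positivity))
  have hwc : ∀ k, Continuous fun x => k + k₀ - 2 * beta b x := fun k => by
    have := h.continuous_beta
    fun_prop
  have hJ := hlim (fun k x => k + k₀ - 2 * beta b x) hwc hweight (fun x => by
    have : Continuous fun k => k + k₀ - 2 * beta b x := by fun_prop
    exact this.tendsto k₀)
  have hN := hlim (fun _ _ => 1) (fun _ => continuous_const) (fun _ _ => hone)
    (fun _ => tendsto_const_nhds)
  have hint₁ : ∀ k, IsBoundState (q k) (u k) (leftSol (q k) R).2 C →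
      Integrable fun x => 1 * (u k x * u k₀ x) := fun k hk =>
    hk.integrable_mul_mul hb₀ continuous_const hone
  have hN0 : 0 < ∫ x, 1 * (u k₀ x * u k₀ x) := by
    have hc := hb₀.isSol.continuous_left
    refine integral_pos_of_integrable_nonneg_nonzero (x := -R)
      (continuous_const.mul (hc.mul hc)) (hint₁ k₀ hb₀) (fun x => ?_) ?_
    · exact mul_nonneg zero_le_one (mul_self_nonneg _)
    · have : u k₀ (-R) = 1 := hc₀.leftSol_spec.2.1
      rw [this]
      norm_num
  -- The Wronskian identity for `k` and `k₀`, with `q k - q k₀ = (k - k₀)(k + k₀ - 2β) - (ω k - ω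
  -- k₀)`. Dividing gives the difference quotient exactly.
  have horth : ∀ᶠ k in 𝓝 k₀, (k - k₀) * ∫ x, (k + k₀ - 2 * beta b x) * (u k x * u k₀ x) =
      (ω k - ω k₀) * ∫ x, 1 * (u k x * u k₀ x) := by
    filter_upwards [hev, hbs] with k hk hk'
    have e := hk'.integral_eq_zero hb₀ hk.2.1.continuous hc₀.continuous
      (fun x => by rw [abs_sub_comm]; exact hlip k hk.1 x)
    have e2 : (fun x => (q k x - q k₀ x) * (u k x * u k₀ x)) = fun x =>
        (k - k₀) * ((k + k₀ - 2 * beta b x) * (u k x * u k₀ x)) -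
          (ω k - ω k₀) * (1 * (u k x * u k₀ x)) := by
      funext x
      simp only [hq, fiberPot_sub]
      ring
    rw [e2, integral_sub ((hk'.integrable_mul_mul hb₀ (hwc k) (hweight k hk.1)).const_mul _)
      ((hint₁ k hk').const_mul _), integral_const_mul, integral_const_mul] at e
    linarith
  have hmatch := hc₀.mismatch_eq_iff.1 hm₀
  refine ⟨R, u k₀, _, C, hc₀, hb₀, fun x hx => ?_, fun x hx hx0 => ?_, ?_⟩
  · simp only [hu]
    rw [hc₀.leftSol_eq_weyl.1]
    exact (hc₀.reflect.isWeyl.pos (-x) (by linarith)).ne'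
  -- A zero at some `x ≥ R` would force value and slope to vanish at `R`, hence the whole solution.
  · simp only [hu] at hx0
    rw [(hc₀.leftSol_eq_mul hmatch).1] at hx0
    have h0 := (mul_eq_zero.1 hx0).resolve_right (hc₀.isWeyl.pos x hx).ne'
    exact hc₀.leftSol_ne_zero (funext fun y =>
      (hc₀.isSol.eq_zero hc₀.continuous h0 (by rw [hmatch, h0, mul_zero]) y).1)
  · rw [hasDerivAt_iff_tendsto_slope]
    refine ((hJ.div hN hN0.ne').mono_left nhdsWithin_le_nhds).congr' ?_
    filter_upwards [horth.filter_mono nhdsWithin_le_nhds,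
      (hN.eventually_ne hN0.ne').filter_mono nhdsWithin_le_nhds, self_mem_nhdsWithin]
      with k h1 h2 h3
    have h3 : k - k₀ ≠ 0 := sub_ne_zero.2 h3
    rw [slope_def_field, Pi.div_apply, div_eq_div_iff h2 h3]
    linarith

/-- Adding the virial identity to `c` times the Feynman–Hellmann numerator replaces `k - β`, which
changes sign, by `(k - β)(c - b)`. Strict positivity of this weight near one end suffices, since the
eigenfunction has no zeros for `|x| ≥ R`. -/
theorem deriv_band_pos (h : IsBoundedField bm bp b) (hbm : 0 < bm) {j : ℕ} (hj : 1 ≤ j)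
    {k c : ℝ} (hc : 0 < c) (hnonneg : ∀ x, 0 ≤ (k - beta b x) * (c - b x))
    (hpos : (∀ᶠ x in atBot, 0 < (k - beta b x) * (c - b x)) ∨
      ∀ᶠ x in atTop, 0 < (k - beta b x) * (c - b x)) :
    DifferentiableAt ℝ (band b j) k ∧ 0 < deriv (band b j) k := by
  obtain ⟨R, u, v, C, hq, hu, hleft, hright, hderiv⟩ := h.exists_hasDerivAt_band hbm hj k
  refine ⟨hderiv.differentiableAt, ?_⟩
  rw [hderiv.deriv]
  set E := band b j k
  have huc := hu.isSol.continuous_left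
  have hβc := h.continuous_beta
  have hbp : 0 ≤ bp := hbm.le.trans ((h.mem_Icc 0).1.trans (h.mem_Icc 0).2)
  have hbabs : ∀ x, |b x| ≤ bp := fun x => by
    rw [abs_of_nonneg (hbm.le.trans (h.mem_Icc x).1)]; exact (h.mem_Icc x).2
  set D := 2 * |k| + 2 * bp
  have hD0 : 0 ≤ D := by positivity
  have hw : ∀ x, |k + k - 2 * beta b x| ≤ D * (1 + |x|) :=
    h.abs_two_mul_le hbm.le le_rfl le_rfl
  have hp : ∀ x, |(k + k - 2 * beta b x) * -b x| ≤ D * bp * (1 + |x|) := fun x => by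
    rw [abs_mul, abs_neg, mul_right_comm]
    exact mul_le_mul (hw x) (hbabs x) (abs_nonneg _) (by positivity)
  have hpc : Continuous fun x => (k + k - 2 * beta b x) * -b x := by
    have := h.continuous
    fun_prop
  have hwc : Continuous fun x => k + k - 2 * beta b x := by fun_prop
  have hvirial := hu.integral_deriv_mul_sq (p := fun x => (k + k - 2 * beta b x) * -b x)
    (fun x => ((((h.hasDerivAt_beta x).const_sub k).pow 2).sub_const E).congr_deriv
      (by push_cast; ring)) hpc hp (B := D ^ 2 + |E|) (fun x => by
        have e1 : |k - beta b x| ≤ D * (1 + |x|) := by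
          refine le_trans ?_ (hw x)
          rw [show k + k - 2 * beta b x = 2 * (k - beta b x) by ring, abs_mul, abs_two]
          linarith [abs_nonneg (k - beta b x)]
        have e2 : (k - beta b x) ^ 2 ≤ (D * (1 + |x|)) ^ 2 := by
          rw [← sq_abs]
          exact pow_le_pow_left₀ (abs_nonneg _) e1 2
        have e3 : (1 : ℝ) ≤ (1 + |x|) ^ 2 := one_le_pow₀ (by linarith [abs_nonneg x])
        have e4 := le_mul_of_one_le_right (abs_nonneg E) e3
        rw [fiberPot]
        refine (abs_sub _ _).trans ?_
        rw [abs_of_nonneg (sq_nonneg (k - beta b x)), add_mul, ← mul_pow]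
        exact add_le_add e2 e4)
  have hi₁ := hu.integrable_mul_mul hu hwc hw
  have hi₂ := hu.integrable_mul_mul hu hpc hp
  have hsum : ∀ x, c * ((k + k - 2 * beta b x) * (u x * u x)) +
      (k + k - 2 * beta b x) * -b x * (u x * u x) =
        2 * ((k - beta b x) * (c - b x)) * (u x * u x) := fun x => by ring
  have hint : Integrable fun x => 2 * ((k - beta b x) * (c - b x)) * (u x * u x) := 
    ((hi₁.const_mul c).add hi₂).congr (Eventually.of_forall hsum)
  have hJ : c * ∫ x, (k + k - 2 * beta b x) * (u x * u x) =
      ∫ x, 2 * ((k - beta b x) * (c - b x)) * (u x * u x) := by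
    simp only [← hsum]
    rw [integral_add (hi₁.const_mul c) hi₂, hvirial, integral_const_mul, add_zero]
  obtain ⟨x, hx, hux⟩ : ∃ x, 0 < (k - beta b x) * (c - b x) ∧ u x ≠ 0 := by
    rcases hpos with hpos | hpos
    · obtain ⟨x, hx, hxR⟩ := (hpos.and (eventually_le_atBot (-R))).exists
      exact ⟨x, hx, hleft x hxR⟩
    · obtain ⟨x, hx, hxR⟩ := (hpos.and (eventually_ge_atTop R)).exists
      exact ⟨x, hx, hright x hxR⟩
  have hJ0 : 0 < ∫ x, 2 * ((k - beta b x) * (c - b x)) * (u x * u x) := by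
    have hbc := h.continuous
    refine integral_pos_of_integrable_nonneg_nonzero (x := x) (by fun_prop) hint (fun y => ?_) ?_
    · exact mul_nonneg (mul_nonneg zero_le_two (hnonneg y)) (mul_self_nonneg _)
    · exact mul_ne_zero (mul_ne_zero two_ne_zero hx.ne') (mul_ne_zero hux hux)
  have hN0 : 0 < ∫ x, 1 * (u x * u x) := by
    refine integral_pos_of_integrable_nonneg_nonzero (x := x) (by fun_prop)
      (hu.integrable_mul_mul hu continuous_const (D := 1) fun y => ?_) (fun y => ?_) ?_
    · rw [abs_one]; linarith [abs_nonneg y]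
    · exact mul_nonneg zero_le_one (mul_self_nonneg _)
    · exact mul_ne_zero one_ne_zero (mul_ne_zero hux hux)
  rw [← hJ] at hJ0
  exact div_pos (pos_of_mul_pos_right hJ0 hc.le) hN0

end IsBoundedField

end Iwatsuka

theorem lemma5p2 (bm bp ε : ℝ) (hbm : 0 < bm) (hbp : bm < bp) (hε : 0 < ε)
    (b : ℝ → ℝ) (hb : Iwatsuka.IsSmoothedField bm bp ε b) (hb1 : ContDiff ℝ 1 b)
    (j : ℕ) (hj : 1 ≤ j) (k : ℝ) (hk : bp * ε < |k|) :
    DifferentiableAt ℝ (Iwatsuka.band b j) k ∧ 0 < deriv (Iwatsuka.band b j) k := by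
  have h := hb.isBoundedField hbp.le hb1.continuous
  have h0 : Iwatsuka.beta b 0 = 0 := by simp [Iwatsuka.beta]
  rcases lt_abs.1 hk with hk | hk
  · have hlt : ∀ x, x ≤ ε → 0 < k - Iwatsuka.beta b x := fun x hx => by
      have h1 := (h.beta_sub hx).1
      have h2 := (h.beta_sub hε.le).2
      have h3 := mul_nonneg hbm.le (sub_nonneg.2 hx)
      linarith
    -- For `k > bp ε` the choice is `c = bp`: the weight vanishes right of `ε`, where `k - β`
    -- changes sign, and is positive left of `-ε`.
    refine h.deriv_band_pos hbm hj (hbm.trans hbp) (fun x => ?_) (Or.inl ?_)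
    · rcases le_or_gt x ε with hx | hx
      · exact mul_nonneg (hlt x hx).le (sub_nonneg.2 (h.mem_Icc x).2)
      · rw [hb.eq_right x hx, sub_self, mul_zero]
    · filter_upwards [Filter.eventually_lt_atBot (-ε)] with x hx
      rw [hb.eq_left x hx]
      exact mul_pos (hlt x (by linarith)) (sub_pos.2 hbp)
  · have hlt : ∀ x, -ε ≤ x → k - Iwatsuka.beta b x < 0 := fun x hx => by
      have h1 := (h.beta_sub hx).1
      have h2 := (h.beta_sub (neg_nonpos.2 hε.le)).2
      have h3 := mul_nonneg hbm.le (sub_nonneg.2 hx)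
      linarith
    -- For `k < -bp ε` the choice is `c = bm`: the weight vanishes left of `-ε` and is a product of
    -- two negative factors right of `ε`.
    refine h.deriv_band_pos hbm hj hbm (fun x => ?_) (Or.inr ?_)
    · rcases le_or_gt (-ε) x with hx | hx
      · exact mul_nonneg_of_nonpos_of_nonpos (hlt x hx).le (sub_nonpos.2 (h.mem_Icc x).1)
      · rw [hb.eq_left x hx, sub_self, mul_zero]
    · filter_upwards [Filter.eventually_gt_atTop ε] with x hx
      rw [hb.eq_right x hx]
      exact mul_pos_of_neg_of_neg (hlt x (by linarith)) (sub_neg.2 hbp)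

end
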